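/- Consider equilateral pentagons in the plane with unit edges and unit point masses at the vertices $z_1,\dots,z_5\in\mathbb C$, centre of mass at $0$. Let $\theta$ be the direction of the first edge, $z_2-z_1=e^{i\theta}$, and let $\psi_i$ be the relative angles, $e^{i\psi_i}(z_{i+1}-z_i)=-(z_i-z_{i-1})$, so that $z_3=z_2-e^{i(\theta-\psi_2)}$, $z_4=z_3+e^{i(\theta-\psi_2-\psi_3)}$, $z_5=z_4-e^{i(\theta-\psi_2-\psi_3-\psi_4)}$. Labelled shape space is the set of $(\psi_2,\psi_3,\psi_4)\in(\mathbb R/2\pi\mathbb Z)^3$ with $|z_5-z_1|=1$. Use the coordinates $\alpha=(\alpha_1,\alpha_2,\alpha_3)\in\mathbb R^3$ with $\psi_2=\pi-\alpha_2-\alpha_3$, $\psi_3=\alpha_2-\alpha_1-\pi$, $\psi_4=\pi-\alpha_2+\alpha_3$ (mod $2\pi$). In them shape space is given by $$C(\alpha)=3+4\cos\alpha_1\cos\alpha_2+4\cos\alpha_1\cos\alpha_3+4\cos\alpha_2\cos\alpha_3=0 .$$ Put $$I=4+2\cos\alpha_1\cos\alpha_2+\tfrac85\cos\alpha_1\cos\alpha_3+\tfrac{12}5\cos\alpha_2\cos\alpha_3+\tfrac65\sin\alpha_1\sin\alpha_2,$$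 $$\tilde F_1=2+\cos\alpha_1\cos\alpha_2+\tfrac45\cos\alpha_1\cos\alpha_3+\tfrac65\cos\alpha_2\cos\alpha_3+\tfrac35\sin\alpha_1\sin\alpha_2+\tfrac65\sin\alpha_2\sin\alpha_3,$$ $$\tilde F_2=2+\cos\alpha_1\cos\alpha_2+\tfrac45\cos\alpha_1\cos\alpha_3+\tfrac65\cos\alpha_2\cos\alpha_3+\tfrac35\sin\alpha_1\sin\alpha_2+\tfrac45\sin\alpha_1\sin\alpha_3,$$ $$\tilde F_3=\tfrac{12}5+\tfrac85\cos\alpha_1\cos\alpha_2+\tfrac45\cos\alpha_1\cos\alpha_3+\tfrac65\cos\alpha_2\cos\alpha_3+\tfrac85\sin\alpha_1\sin\alpha_2,$$ $\mathbf F=-\tilde{\mathbf F}/I$ and $B=(\nabla\times\mathbf F)\cdot\nabla C$, with $\nabla$ taken in the coordinates $\alpha$. Then the following hold. 1. $I=\sum_i|z_i|^2>0$, and along every differentiable motion $(\theta(t),\alpha(t))$ the angular momentum $L=\sum_i\operatorname{Im}(\bar z_i\dot z_i)$ equals $I\dot\theta+\sum_i\tilde F_i\dot\alpha_i$. 2.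 Let $\alpha:[0,1]\to\mathbb R^3$ be a $C^1$ curve in $\{C=0\}$ that describes a closed loop $\gamma$ in shape space. For every initial orientation there is a motion $\theta$ with $L=0$ along $\alpha$, and every such motion has $$\Delta\theta=\theta(1)-\theta(0)=\int_0^1\mathbf F(\alpha(t))\cdot\dot\alpha(t)\,dt=\oint_\gamma\mathbf F\cdot d\alpha .$$ 3. Suppose moreover that $\gamma$ is contractible (null-homotopic in shape space) and $\alpha$ is $C^2$ on $[0,1]$. Then $\alpha(1)=\alpha(0)$, and there is a disc in $\{C=0\}$ bounded by $\alpha$, that is, a $C^2$ map $\sigma:[0,1]^2\to\{C=0\}$, in polar parameters $(s,t)$, with $\sigma(1,t)=\alpha(t)$, $\sigma(0,t)$ independent of $t$, and $\sigma(s,0)=\sigma(s,1)$. For every such disc $S$, $$\Delta\theta=\iint_S(\nabla\times\mathbf F)\cdot d\mathbf S=\int_{(0,1)^2}(\nabla\times\mathbf F)(\sigma)\cdot(\partial_s\sigma\times\partial_t\sigma)\,ds\,dt .$$ Here $\partial_s\sigma\times\partial_t\sigma=k\,\nabla C(\sigma)$ on $(0,1)^2$ for a real function $k$ which is nonzero wherever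 $\partial_s\sigma\times\partial_t\sigma\neq0$, so that the integrand is $k\,B(\sigma)$ and $\Delta\theta=\int_{(0,1)^2} k\,B(\sigma)\,ds\,dt$. If $\partial_s\sigma\times\partial_t\sigma\ne0$ on all of $(0,1)^2$ (in particular if $\sigma$ regularly parametrizes the region enclosed by a simple loop), then there is a constant $\varepsilon\in\{1,-1\}$, giving the orientation of $\partial_s\sigma\times\partial_t\sigma$ relative to $\nabla C$, with $$\Delta\theta=\varepsilon\iint_S\frac{B}{|\nabla C|}\,dS ,\qquad dS=|\partial_s\sigma\times\partial_t\sigma|\,ds\,dt .$$ All these integrals converge absolutely. 4. $\nabla C\neq0$ on $C=0$. Where the surface $C=0$ is a differentiable graph $\alpha_3=a(\alpha_1,\alpha_2)$ with $C_3=\partial C/\partial\alpha_3\ne0$, one has $(\nabla\times\mathbf F)\cdot d\mathbf S=(B/C_3)\,d\alpha_1d\alpha_2$ and $dS=(|\nabla C|/|C_3|)\,d\alpha_1d\alpha_2$. 5. For all $\alpha\in\mathbb R^3$, $$\begin{aligned}\tfrac58I^2B={}&\cos3\alpha_3\,[\cos\alpha_1+\cos\alpha_2]+\cos2\alpha_3\,[3+2\cos(\alpha_1-\alpha_2)+\cos(\alpha_1+\alpha_2)]\\&+\cos\alpha_3\,[\cos\alpha_1+\cos\alpha_2-\cos3\alpha_2-\cos(2\alpha_1-\alpha_2)-2\cos(\alpha_1+2\alpha_2)]\\&+\sin\alpha_1\sin\alpha_2-\cos\alpha_1(2\cos\alpha_2+\cos3\alpha_2)-\cos2\alpha_1-2\cos2\alpha_2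 .\end{aligned}$$ 6. Let $D_{10}$ be the group generated by $R(z_1,\dots,z_5)=(z_2,z_3,z_4,z_5,z_1)$, $V(z_1,\dots,z_5)=(z_5,z_4,z_3,z_2,z_1)$ and $M(z_1,\dots,z_5)=(\bar z_1,\dots,\bar z_5)$. It acts on labelled shapes: for all $g\in D_{10}$ and $\alpha$ with $C(\alpha)=0$ there is $\beta$ with $C(\beta)=0$ representing the image of the shape of $\alpha$ under $g$, meaning that a pentagon with shape coordinates $\beta$ is the $g$-image of a pentagon with shape coordinates $\alpha$. The function $B$ is invariant: $B(\beta)=B(\alpha)$ for every such $\beta$. -/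

import Mathlib

open Set MeasureTheory
open scoped Matrix

noncomputable section

namespace Pentagon

/-- Relative angles `(ψ₂, ψ₃, ψ₄)` as functions of the coordinates `(α₁, α₂, α₃)`. This is the
inverse of `α₁ = -ψ₂/2 - ψ₃ - ψ₄/2`, `α₂ = π - ψ₂/2 - ψ₄/2`, `α₃ = -ψ₂/2 + ψ₄/2`. -/
def relAngles (α : Fin 3 → ℝ) : Fin 3 → ℝ :=
  ![-(α 1 - Real.pi) - α 2, -α 0 + (α 1 - Real.pi), -(α 1 - Real.pi) + α 2]

/-- The unit complex number `e^{i x}`. -/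
def cis (x : ℝ) : ℂ := Complex.exp ((x : ℂ) * Complex.I)

/-- The vertices `z₁, …, z₅` (indexed by `0, …, 4`) of the pentagon with centre of mass at the
origin, orientation `θ` (so that `z₂ - z₁ = e^{iθ}`) and shape coordinates `α`. -/
def vertices (θ : ℝ) (α : Fin 3 → ℝ) : Fin 5 → ℂ :=
  let a : ℂ := cis (-(relAngles α 0))
  let b : ℂ := cis (-(relAngles α 0 + relAngles α 1))
  let c : ℂ := cis (-(relAngles α 0 + relAngles α 1 + relAngles α 2))
  ![(1 / 5) * cis θ * (-4 + 3 * a - 2 * b + c),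
    (1 / 5) * cis θ * (1 + 3 * a - 2 * b + c),
    (1 / 5) * cis θ * (1 - 2 * a - 2 * b + c),
    (1 / 5) * cis θ * (1 - 2 * a + 3 * b + c),
    (1 / 5) * cis θ * (1 - 2 * a + 3 * b - 4 * c)]

/-- Labelled shape space: the relative angles `(ψ₂, ψ₃, ψ₄)` in the three-torus for which the chain
of unit edges closes up, that is `|z₅ - z₁|² - 1 = 0`. -/
def shapeSpace : Set (Fin 3 → Real.Angle) :=
  {ψ | 3 - 2 * (ψ 0).cos - 2 * (ψ 1).cos - 2 * (ψ 2).cos + 2 * (ψ 0 + ψ 1).cos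
    + 2 * (ψ 1 + ψ 2).cos - 2 * (ψ 0 + ψ 1 + ψ 2).cos = 0}

/-- The constraint function `C`; in `α`-coordinates shape space is `C = 0`. -/
def constraint (α : Fin 3 → ℝ) : ℝ :=
  3 + 4 * Real.cos (α 0) * Real.cos (α 1) + 4 * Real.cos (α 0) * Real.cos (α 2)
    + 4 * Real.cos (α 1) * Real.cos (α 2)

/-- The moment of inertia `I` in `α`-coordinates. -/
def inertia (α : Fin 3 → ℝ) : ℝ :=
  4 + 2 * Real.cos (α 0) * Real.cos (α 1) + 8 / 5 * Real.cos (α 0) * Real.cos (α 2)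
    + 12 / 5 * Real.cos (α 1) * Real.cos (α 2) + 6 / 5 * Real.sin (α 0) * Real.sin (α 1)

/-- The coefficients `F̃₁, F̃₂, F̃₃` of the shape velocities in the angular momentum. -/
def Ftilde (α : Fin 3 → ℝ) : Fin 3 → ℝ :=
  ![2 + Real.cos (α 0) * Real.cos (α 1) + 4 / 5 * Real.cos (α 0) * Real.cos (α 2)
      + 6 / 5 * Real.cos (α 1) * Real.cos (α 2) + 3 / 5 * Real.sin (α 0) * Real.sin (α 1)
      + 6 / 5 * Real.sin (α 1) * Real.sin (α 2),
    2 + Real.cos (α 0) * Real.cos (α 1) + 4 / 5 * Real.cos (α 0) * Real.cos (α 2)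
      + 6 / 5 * Real.cos (α 1) * Real.cos (α 2) + 3 / 5 * Real.sin (α 0) * Real.sin (α 1)
      + 4 / 5 * Real.sin (α 0) * Real.sin (α 2),
    12 / 5 + 8 / 5 * Real.cos (α 0) * Real.cos (α 1) + 4 / 5 * Real.cos (α 0) * Real.cos (α 2)
      + 6 / 5 * Real.cos (α 1) * Real.cos (α 2) + 8 / 5 * Real.sin (α 0) * Real.sin (α 1)]

/-- The vector field `F = -F̃ / I`. -/
def F (α : Fin 3 → ℝ) : Fin 3 → ℝ := fun i => -(Ftilde α i) / inertia α

/-- The partial derivative `∂f/∂αⱼ`. -/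
def partialD (f : (Fin 3 → ℝ) → ℝ) (j : Fin 3) (α : Fin 3 → ℝ) : ℝ :=
  fderiv ℝ f α (Pi.single j 1)

/-- The gradient in the coordinates `α`. -/
def grad (f : (Fin 3 → ℝ) → ℝ) (α : Fin 3 → ℝ) : Fin 3 → ℝ := fun j => partialD f j α

/-- The curl in the coordinates `α`. -/
def curl (G : (Fin 3 → ℝ) → (Fin 3 → ℝ)) (α : Fin 3 → ℝ) : Fin 3 → ℝ :=
  ![partialD (fun x => G x 2) 1 α - partialD (fun x => G x 1) 2 α,
    partialD (fun x => G x 0) 2 α - partialD (fun x => G x 2) 0 α,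
    partialD (fun x => G x 1) 0 α - partialD (fun x => G x 0) 1 α]

/-- The Euclidean length of a vector in `ℝ³`. -/
def len (v : Fin 3 → ℝ) : ℝ := Real.sqrt (v ⬝ᵥ v)

/-- The magnetic field `B = (∇ × F) · ∇C`. -/
def magneticField (α : Fin 3 → ℝ) : ℝ := curl F α ⬝ᵥ grad constraint α

/-- The angular momentum `∑ᵢ Im (z̄ᵢ żᵢ)` at time `t` of five unit point masses moving along `z`,
the velocities being taken within the time set `s`. -/
def angularMomentum (s : Set ℝ) (z : ℝ → Fin 5 → ℂ) (t : ℝ) : ℝ :=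
  ∑ i, (starRingEnd ℂ (z t i) * derivWithin (fun τ => z τ i) s t).im

/-- Vertex rotation `R (z₁, z₂, z₃, z₄, z₅) = (z₂, z₃, z₄, z₅, z₁)`. -/
def vertexRotation : Equiv.Perm (Fin 5 → ℂ) where
  toFun z := fun i => z (i + 1)
  invFun z := fun i => z (i - 1)
  left_inv z := by funext i; simp
  right_inv z := by funext i; simp

/-- Vertex reflection `V (z₁, z₂, z₃, z₄, z₅) = (z₅, z₄, z₃, z₂, z₁)`. -/
def vertexReflection : Equiv.Perm (Fin 5 → ℂ) where
  toFun z := fun i => z i.rev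
  invFun z := fun i => z i.rev
  left_inv z := by funext i; simp
  right_inv z := by funext i; simp

/-- Mirror reflection `M (z₁, …, z₅) = (z̄₁, …, z̄₅)`. -/
def mirror : Equiv.Perm (Fin 5 → ℂ) where
  toFun z := fun i => starRingEnd ℂ (z i)
  invFun z := fun i => starRingEnd ℂ (z i)
  left_inv z := by funext i; simp
  right_inv z := by funext i; simp

/-- The discrete symmetry group `D₁₀ ≅ D₅ × ℤ₂` generated by `R`, `V` and `M`. -/
def D10 : Subgroup (Equiv.Perm (Fin 5 → ℂ)) :=
  Subgroup.closure {vertexRotation, vertexReflection, mirror}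

/-- `β` represents the image of the labelled shape represented by `α` under `g`: the pentagon of
shape `β`, suitably rotated, is obtained by applying `g` to a pentagon of shape `α`. -/
def IsImage (g : Equiv.Perm (Fin 5 → ℂ)) (α β : Fin 3 → ℝ) : Prop :=
  ∃ θ φ : ℝ, vertices φ β = g (vertices θ α)

/-- The curve `α`, on `[0,1]`, describes in `α`-coordinates the loop `γ` in shape space. -/
def Represents {p : shapeSpace} (α : ℝ → Fin 3 → ℝ) (γ : Path p p) : Prop :=
  ∀ t : unitInterval, ∀ i : Fin 3,
    (γ t : Fin 3 → Real.Angle) i = ((relAngles (α t) i : ℝ) : Real.Angle)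

/-- A loop is contractible if it is null-homotopic in shape space. -/
def Contractible {p : shapeSpace} (γ : Path p p) : Prop := γ.Homotopic (Path.refl p)

/-- `(θ, α)` is a motion of the pentagon during `[0,1]` with zero angular momentum. -/
def ZeroMomentum (θ : ℝ → ℝ) (α : ℝ → Fin 3 → ℝ) : Prop :=
  DifferentiableOn ℝ θ (Icc 0 1) ∧
    ∀ t ∈ Icc (0 : ℝ) 1, angularMomentum (Icc 0 1) (fun τ => vertices (θ τ) (α τ)) t = 0

/-- `σ` parametrizes a disc `S` in the surface `C = 0` with boundary curve `α`. The parameters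
`(s, t)` are polar coordinates on the disc: `s = 0` is the centre, `s = 1` is the boundary and
`t = 0`, `t = 1` are the same ray. -/
structure IsSpanningDisc (α : ℝ → Fin 3 → ℝ) (σ : ℝ × ℝ → Fin 3 → ℝ) : Prop where
  contDiffOn : ContDiffOn ℝ 2 σ (Icc 0 1 ×ˢ Icc 0 1)
  mem_surface : ∀ x ∈ Icc (0 : ℝ) 1 ×ˢ Icc (0 : ℝ) 1, constraint (σ x) = 0
  boundary : ∀ t ∈ Icc (0 : ℝ) 1, σ (1, t) = α t
  centre : ∀ t ∈ Icc (0 : ℝ) 1, σ (0, t) = σ (0, 0)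
  seam : ∀ s ∈ Icc (0 : ℝ) 1, σ (s, 0) = σ (s, 1)

/-- The normal vector `∂₁σ × ∂₂σ` of a parametrized surface, so that the vector and scalar area
elements are `dS = (∂₁σ × ∂₂σ) ds dt` and `dS = |∂₁σ × ∂₂σ| ds dt`. -/
def normalVec (σ : ℝ × ℝ → Fin 3 → ℝ) (x : ℝ × ℝ) : Fin 3 → ℝ :=
  crossProduct (fderiv ℝ σ x (1, 0)) (fderiv ℝ σ x (0, 1))

/-- The open parameter square. -/
def square : Set (ℝ × ℝ) := Ioo 0 1 ×ˢ Ioo 0 1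

/-- The flux `∬ G · dS` of a vector field through a parametrized surface. -/
def flux (G : (Fin 3 → ℝ) → (Fin 3 → ℝ)) (σ : ℝ × ℝ → Fin 3 → ℝ) : ℝ :=
  ∫ x in square, G (σ x) ⬝ᵥ normalVec σ x

/-- The area integral `∬ f dS` of a function over a parametrized surface. -/
def areaIntegral (f : (Fin 3 → ℝ) → ℝ) (σ : ℝ × ℝ → Fin 3 → ℝ) : ℝ :=
  ∫ x in square, f (σ x) * len (normalVec σ x)

/-- The line integral `∫ G · dα` along the curve `α` on `[0,1]`. -/
def lineIntegral (G : (Fin 3 → ℝ) → (Fin 3 → ℝ)) (α : ℝ → Fin 3 → ℝ) : ℝ :=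
  ∫ t in (0 : ℝ)..1, G (α t) ⬝ᵥ derivWithin α (Icc 0 1) t

end Pentagon

end

open Pentagon

noncomputable section

namespace Pentagon

/-! ### Vertices, moment of inertia and angular momentum -/

lemma cis_re (x : ℝ) : (cis x).re = Real.cos x := by
  rw [cis, Complex.exp_ofReal_mul_I_re]

lemma cis_im (x : ℝ) : (cis x).im = Real.sin x := by
  rw [cis, Complex.exp_ofReal_mul_I_im]

lemma norm_cis (x : ℝ) : ‖cis x‖ = 1 := Complex.norm_exp_ofReal_mul_I x

lemma conj_cis_mul_self (x : ℝ) : starRingEnd ℂ (cis x) * cis x = 1 := by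
  rw [← Complex.normSq_eq_conj_mul_self, Complex.normSq_eq_norm_sq, norm_cis]
  simp

lemma hasDerivWithinAt_cis {f : ℝ → ℝ} {f' : ℝ} {s : Set ℝ} {t : ℝ}
    (hf : HasDerivWithinAt f f' s t) :
    HasDerivWithinAt (fun τ => cis (f τ)) (Complex.I * f' * cis (f t)) s t := by
  have h := (hf.ofReal_comp.mul_const Complex.I).cexp
  refine h.congr_deriv ?_
  rw [cis]
  ring

/-- The directions of the edges two to four relative to the first one. -/
def edgeAngle (α : Fin 3 → ℝ) : Fin 3 → ℝ :=
  ![α 1 + α 2 - Real.pi, α 0 + α 2, α 0 + α 1 - Real.pi]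

/-- The vertices in the frame of the first edge, as functions of the other edges. -/
def vertexForm (a b c : ℂ) : Fin 5 → ℂ :=
  ![(1 / 5) * (-4 + 3 * a - 2 * b + c), (1 / 5) * (1 + 3 * a - 2 * b + c),
    (1 / 5) * (1 - 2 * a - 2 * b + c), (1 / 5) * (1 - 2 * a + 3 * b + c),
    (1 / 5) * (1 - 2 * a + 3 * b - 4 * c)]

lemma vertices_eq (θ : ℝ) (α : Fin 3 → ℝ) (i : Fin 5) :
    vertices θ α i = cis θ * vertexForm (cis (edgeAngle α 0)) (cis (edgeAngle α 1))
      (cis (edgeAngle α 2)) i := by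
  have h0 : -(relAngles α 0) = edgeAngle α 0 := by simp [relAngles, edgeAngle]; ring
  have h1 : -(relAngles α 0 + relAngles α 1) = edgeAngle α 1 := by
    simp [relAngles, edgeAngle]; ring
  have h2 : -(relAngles α 0 + relAngles α 1 + relAngles α 2) = edgeAngle α 2 := by
    simp [relAngles, edgeAngle]; ring
  simp only [vertices, h0, h1, h2, vertexForm]
  fin_cases i <;> simp <;> ring

lemma cos_edgeAngle_zero (α : Fin 3 → ℝ) : Real.cos (edgeAngle α 0) =
    -(Real.cos (α 1) * Real.cos (α 2) - Real.sin (α 1) * Real.sin (α 2)) := by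
  simp [edgeAngle, Real.cos_sub_pi, Real.cos_add]

lemma cos_edgeAngle_one (α : Fin 3 → ℝ) : Real.cos (edgeAngle α 1) =
    Real.cos (α 0) * Real.cos (α 2) - Real.sin (α 0) * Real.sin (α 2) := by
  simp [edgeAngle, Real.cos_add]

lemma cos_edgeAngle_two (α : Fin 3 → ℝ) : Real.cos (edgeAngle α 2) =
    -(Real.cos (α 0) * Real.cos (α 1) - Real.sin (α 0) * Real.sin (α 1)) := by
  simp [edgeAngle, Real.cos_sub_pi, Real.cos_add]

lemma dot_edge_zero_one (α : Fin 3 → ℝ) :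
    Real.cos (edgeAngle α 0) * Real.cos (edgeAngle α 1) +
      Real.sin (edgeAngle α 0) * Real.sin (edgeAngle α 1) =
    -(Real.cos (α 0) * Real.cos (α 1) + Real.sin (α 0) * Real.sin (α 1)) := by
  rw [← Real.cos_sub, ← Real.cos_sub, ← Real.cos_sub_pi, ← Real.cos_neg]
  simp only [edgeAngle, Matrix.cons_val]
  rw [show -(α 1 + α 2 - Real.pi - (α 0 + α 2)) = α 0 - α 1 - Real.pi + 2 * Real.pi by ring,
    Real.cos_add_two_pi]

lemma dot_edge_zero_two (α : Fin 3 → ℝ) :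
    Real.cos (edgeAngle α 0) * Real.cos (edgeAngle α 2) +
      Real.sin (edgeAngle α 0) * Real.sin (edgeAngle α 2) =
    Real.cos (α 0) * Real.cos (α 2) + Real.sin (α 0) * Real.sin (α 2) := by
  rw [← Real.cos_sub, ← Real.cos_sub, ← Real.cos_neg]
  simp only [edgeAngle, Matrix.cons_val]
  congr 1
  ring

lemma dot_edge_one_two (α : Fin 3 → ℝ) :
    Real.cos (edgeAngle α 1) * Real.cos (edgeAngle α 2) +
      Real.sin (edgeAngle α 1) * Real.sin (edgeAngle α 2) =
    -(Real.cos (α 1) * Real.cos (α 2) + Real.sin (α 1) * Real.sin (α 2)) := by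
  rw [← Real.cos_sub, ← Real.cos_sub, ← Real.cos_sub_pi, ← Real.cos_neg]
  simp only [edgeAngle, Matrix.cons_val]
  rw [show -(α 0 + α 2 - (α 0 + α 1 - Real.pi)) = α 1 - α 2 - Real.pi by ring]

lemma sum_normSq_vertexForm (α : Fin 3 → ℝ) :
    ∑ i, Complex.normSq (vertexForm (cis (edgeAngle α 0)) (cis (edgeAngle α 1))
      (cis (edgeAngle α 2)) i) = inertia α := by
  have h0 := Real.sin_sq_add_cos_sq (edgeAngle α 0)
  have h1 := Real.sin_sq_add_cos_sq (edgeAngle α 1)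
  have h2 := Real.sin_sq_add_cos_sq (edgeAngle α 2)
  simp only [vertexForm, Fin.sum_univ_five, Matrix.cons_val, Complex.normSq_apply, Complex.add_re,
    Complex.add_im, Complex.sub_re, Complex.sub_im, Complex.mul_re, Complex.mul_im, cis_re, cis_im,
    inertia]
  norm_num
  linear_combination (6 / 5) * h0 + (6 / 5) * h1 + (4 / 5) * h2 -
    (8 / 5) * dot_edge_zero_one α + (4 / 5) * dot_edge_zero_two α - 6 / 5 * dot_edge_one_two α
    + 4 / 5 * cos_edgeAngle_one α - 2 / 5 * cos_edgeAngle_two α - 6 / 5 * cos_edgeAngle_zero α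

lemma inertia_eq_sum (θ : ℝ) (α : Fin 3 → ℝ) : inertia α = ∑ i, ‖vertices θ α i‖ ^ 2 := by
  rw [← sum_normSq_vertexForm]
  simp only [vertices_eq, norm_mul, norm_cis, one_mul, Complex.normSq_eq_norm_sq]

lemma vertices_one_sub_zero (θ : ℝ) (α : Fin 3 → ℝ) :
    vertices θ α 1 - vertices θ α 0 = cis θ := by
  simp [vertices_eq, vertexForm]
  ring

lemma inertia_pos (α : Fin 3 → ℝ) : 0 < inertia α := by
  rw [inertia_eq_sum 0]
  refine lt_of_le_of_ne (Finset.sum_nonneg fun i _ => by positivity) fun h => ?_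
  have h0 : ∀ i, vertices 0 α i = 0 := by
    intro i
    have := (Finset.sum_eq_zero_iff_of_nonneg (fun i _ => by positivity)).1 h.symm i
      (Finset.mem_univ i)
    simpa using this
  have h1 := vertices_one_sub_zero 0 α
  rw [h0, h0] at h1
  have := norm_cis 0
  rw [← h1] at this
  simp at this

lemma inertia_ne_zero (α : Fin 3 → ℝ) : inertia α ≠ 0 := (inertia_pos α).ne'

lemma sum_im_vertexForm (α : Fin 3 → ℝ) (v : Fin 3 → ℝ) :
    ∑ i, (starRingEnd ℂ (vertexForm (cis (edgeAngle α 0)) (cis (edgeAngle α 1))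
        (cis (edgeAngle α 2)) i) *
      (vertexForm (Complex.I * (v 1 + v 2 : ℝ) * cis (edgeAngle α 0))
        (Complex.I * (v 0 + v 2 : ℝ) * cis (edgeAngle α 1))
        (Complex.I * (v 0 + v 1 : ℝ) * cis (edgeAngle α 2)) i - vertexForm 0 0 0 i)).im =
      Ftilde α ⬝ᵥ v := by
  have h0 := Real.sin_sq_add_cos_sq (edgeAngle α 0)
  have h1 := Real.sin_sq_add_cos_sq (edgeAngle α 1)
  have h2 := Real.sin_sq_add_cos_sq (edgeAngle α 2)
  simp only [vertexForm, Fin.sum_univ_five, Matrix.cons_val, Complex.add_re,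
    Complex.add_im, Complex.sub_re, Complex.sub_im, Complex.mul_re, Complex.mul_im, cis_re, cis_im,
    Ftilde, Complex.conj_re, Complex.conj_im, Complex.I_re, Complex.I_im, dotProduct,
    Fin.sum_univ_three]
  norm_num
  generalize v 0 = v0
  generalize v 1 = v1
  generalize v 2 = v2
  linear_combination (v1 + v2) * (6 / 5 * h0 - 4 / 5 * dot_edge_zero_one α
      + 2 / 5 * dot_edge_zero_two α - 3 / 5 * cos_edgeAngle_zero α)
    + (v0 + v2) * (6 / 5 * h1 - 4 / 5 * dot_edge_zero_one α
      - 3 / 5 * dot_edge_one_two α + 2 / 5 * cos_edgeAngle_one α)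
    + (v0 + v1) * (4 / 5 * h2 + 2 / 5 * dot_edge_zero_two α
      - 3 / 5 * dot_edge_one_two α - 1 / 5 * cos_edgeAngle_two α)

lemma angularMomentum_vertices {s : Set ℝ} {t : ℝ} {θ : ℝ → ℝ} {α : ℝ → Fin 3 → ℝ}
    (hs : UniqueDiffWithinAt ℝ s t) (hθ : DifferentiableWithinAt ℝ θ s t)
    (hα : DifferentiableWithinAt ℝ α s t) :
    angularMomentum s (fun τ => vertices (θ τ) (α τ)) t =
      inertia (α t) * derivWithin θ s t + Ftilde (α t) ⬝ᵥ derivWithin α s t := by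
  set θ' := derivWithin θ s t
  set α' := derivWithin α s t
  have hθ' : HasDerivWithinAt θ θ' s t := hθ.hasDerivWithinAt
  have hα' : ∀ i, HasDerivWithinAt (fun τ => α τ i) (α' i) s t :=
    hasDerivWithinAt_pi.1 hα.hasDerivWithinAt
  have e0 : HasDerivWithinAt (fun τ => edgeAngle (α τ) 0) (α' 1 + α' 2) s t :=
    ((hα' 1).add (hα' 2)).sub_const Real.pi
  have e1 : HasDerivWithinAt (fun τ => edgeAngle (α τ) 1) (α' 0 + α' 2) s t :=
    (hα' 0).add (hα' 2)
  have e2 : HasDerivWithinAt (fun τ => edgeAngle (α τ) 2) (α' 0 + α' 1) s t :=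
    ((hα' 0).add (hα' 1)).sub_const Real.pi
  have c0 := hasDerivWithinAt_cis e0
  have c1 := hasDerivWithinAt_cis e1
  have c2 := hasDerivWithinAt_cis e2
  have hw : ∀ i, HasDerivWithinAt (fun τ => vertexForm (cis (edgeAngle (α τ) 0))
      (cis (edgeAngle (α τ) 1)) (cis (edgeAngle (α τ) 2)) i)
      (vertexForm (Complex.I * (α' 1 + α' 2 : ℝ) * cis (edgeAngle (α t) 0))
        (Complex.I * (α' 0 + α' 2 : ℝ) * cis (edgeAngle (α t) 1))
        (Complex.I * (α' 0 + α' 1 : ℝ) * cis (edgeAngle (α t) 2)) i - vertexForm 0 0 0 i) s t := by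
    intro i
    have key : ∀ k l m n : ℂ, HasDerivWithinAt (fun τ => (1 / 5) * (k + l * cis (edgeAngle (α τ) 0)
        + m * cis (edgeAngle (α τ) 1) + n * cis (edgeAngle (α τ) 2)))
        ((1 / 5) * (l * (Complex.I * (α' 1 + α' 2 : ℝ) * cis (edgeAngle (α t) 0))
          + m * (Complex.I * (α' 0 + α' 2 : ℝ) * cis (edgeAngle (α t) 1))
          + n * (Complex.I * (α' 0 + α' 1 : ℝ) * cis (edgeAngle (α t) 2)))) s t := fun k l m n =>
      ((((c0.const_mul l).const_add k).add (c1.const_mul m)).add (c2.const_mul n)).const_mul _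
    fin_cases i
    · refine ((key (-4) 3 (-2) 1).congr_deriv ?_).congr_of_eventuallyEq
        (Filter.Eventually.of_forall fun τ => ?_) ?_ <;> simp [vertexForm] <;> ring
    · refine ((key 1 3 (-2) 1).congr_deriv ?_).congr_of_eventuallyEq
        (Filter.Eventually.of_forall fun τ => ?_) ?_ <;> simp [vertexForm] <;> ring
    · refine ((key 1 (-2) (-2) 1).congr_deriv ?_).congr_of_eventuallyEq
        (Filter.Eventually.of_forall fun τ => ?_) ?_ <;> simp [vertexForm] <;> ring
    · refine ((key 1 (-2) 3 1).congr_deriv ?_).congr_of_eventuallyEq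
        (Filter.Eventually.of_forall fun τ => ?_) ?_ <;> simp [vertexForm] <;> ring
    · refine ((key 1 (-2) 3 (-4)).congr_deriv ?_).congr_of_eventuallyEq
        (Filter.Eventually.of_forall fun τ => ?_) ?_ <;> simp [vertexForm] <;> ring
  have hz : ∀ i, derivWithin (fun τ => vertices (θ τ) (α τ) i) s t = _ := fun i =>
    (((hasDerivWithinAt_cis hθ').mul (hw i)).congr_of_eventuallyEq
      (Filter.Eventually.of_forall fun τ => vertices_eq _ _ i) (vertices_eq _ _ i)).derivWithin hs
  rw [← sum_im_vertexForm, ← sum_normSq_vertexForm, Finset.sum_mul, ← Finset.sum_add_distrib]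
  refine Finset.sum_congr rfl fun i _ => ?_
  rw [hz]
  beta_reduce
  rw [vertices_eq]
  generalize vertexForm (cis (edgeAngle (α t) 0)) (cis (edgeAngle (α t) 1))
    (cis (edgeAngle (α t) 2)) i = w
  generalize vertexForm _ _ _ i - vertexForm 0 0 0 i = w'
  have hc := conj_cis_mul_self (θ t)
  rw [show starRingEnd ℂ (cis (θ t) * w) * (Complex.I * θ' * cis (θ t) * w + cis (θ t) * w') =
    (starRingEnd ℂ (cis (θ t)) * cis (θ t)) * (starRingEnd ℂ w * w * (θ' * Complex.I)
      + starRingEnd ℂ w * w') by rw [map_mul]; ring, hc, one_mul,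
    ← Complex.normSq_eq_conj_mul_self, Complex.add_im]
  congr 1
  rw [← mul_assoc, ← Complex.ofReal_mul]
  simp

/-! ### Gradients and the explicit formula for the magnetic field -/

lemma contDiff_constraint {n : WithTop ℕ∞} : ContDiff ℝ n constraint := by
  unfold constraint; fun_prop

lemma contDiff_inertia {n : WithTop ℕ∞} : ContDiff ℝ n inertia := by
  unfold inertia; fun_prop

lemma contDiff_Ftilde {n : WithTop ℕ∞} : ContDiff ℝ n Ftilde := by
  rw [contDiff_pi]
  intro i
  unfold Ftilde
  fin_cases i <;> simp <;> fun_prop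

lemma contDiff_F {n : WithTop ℕ∞} : ContDiff ℝ n F := by
  rw [contDiff_pi]
  exact fun i => ((contDiff_pi.1 contDiff_Ftilde i).neg).div contDiff_inertia inertia_ne_zero

lemma grad_constraint (α : Fin 3 → ℝ) : grad constraint α =
    ![-4 * Real.sin (α 0) * (Real.cos (α 1) + Real.cos (α 2)),
      -4 * Real.sin (α 1) * (Real.cos (α 0) + Real.cos (α 2)),
      -4 * Real.sin (α 2) * (Real.cos (α 0) + Real.cos (α 1))] := by
  ext j
  unfold grad partialD constraint
  simp (disch := fun_prop) only [fderiv_fun_add, fderiv_fun_mul, fderiv_cos, fderiv_apply,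
    fderiv_fun_const]
  fin_cases j <;> simp <;> ring

lemma grad_inertia (α : Fin 3 → ℝ) : grad inertia α =
    ![-2 * Real.sin (α 0) * Real.cos (α 1) - 8 / 5 * Real.sin (α 0) * Real.cos (α 2)
        + 6 / 5 * Real.cos (α 0) * Real.sin (α 1),
      -2 * Real.cos (α 0) * Real.sin (α 1) - 12 / 5 * Real.sin (α 1) * Real.cos (α 2)
        + 6 / 5 * Real.sin (α 0) * Real.cos (α 1),
      -8 / 5 * Real.cos (α 0) * Real.sin (α 2) - 12 / 5 * Real.cos (α 1) * Real.sin (α 2)] := by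
  ext j
  unfold grad partialD inertia
  simp (disch := fun_prop) only [fderiv_fun_add, fderiv_fun_mul, fderiv_cos, fderiv_sin,
    fderiv_apply, fderiv_fun_const]
  fin_cases j <;> simp <;> ring

lemma curl_Ftilde (α : Fin 3 → ℝ) : curl Ftilde α =
    ![8 / 5 * Real.sin (α 0) * Real.cos (α 1) - 8 / 5 * Real.cos (α 0) * Real.sin (α 1)
        + 4 / 5 * Real.cos (α 0) * Real.sin (α 2) - 4 / 5 * Real.sin (α 0) * Real.cos (α 2)
        + 6 / 5 * Real.cos (α 1) * Real.sin (α 2) - 6 / 5 * Real.sin (α 1) * Real.cos (α 2),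
      8 / 5 * Real.sin (α 0) * Real.cos (α 1) - 8 / 5 * Real.cos (α 0) * Real.sin (α 1)
        - 4 / 5 * Real.cos (α 0) * Real.sin (α 2) + 4 / 5 * Real.sin (α 0) * Real.cos (α 2)
        - 6 / 5 * Real.cos (α 1) * Real.sin (α 2) + 6 / 5 * Real.sin (α 1) * Real.cos (α 2),
      8 / 5 * Real.cos (α 0) * Real.sin (α 1) - 8 / 5 * Real.sin (α 0) * Real.cos (α 1)
        + 4 / 5 * Real.cos (α 0) * Real.sin (α 2) - 4 / 5 * Real.sin (α 0) * Real.cos (α 2)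
        - 6 / 5 * Real.cos (α 1) * Real.sin (α 2) + 6 / 5 * Real.sin (α 1) * Real.cos (α 2)] := by
  ext j
  unfold curl partialD Ftilde
  simp (disch := fun_prop) only [Matrix.cons_val, fderiv_fun_add, fderiv_fun_mul, fderiv_cos,
    fderiv_sin, fderiv_apply, fderiv_fun_const]
  fin_cases j <;> simp <;> ring_nf

lemma partialD_F (i j : Fin 3) (α : Fin 3 → ℝ) : partialD (fun x => F x i) j α =
    (-partialD (fun x => Ftilde x i) j α * inertia α + Ftilde α i * grad inertia α j)
      / inertia α ^ 2 := by
  have h1 : HasFDerivAt (fun x => -Ftilde x i) (-fderiv ℝ (fun x => Ftilde x i) α) α :=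
    ((contDiff_pi.1 (contDiff_Ftilde (n := 1)) i).differentiable (by simp) α).hasFDerivAt.neg
  have h2 : HasFDerivAt inertia (fderiv ℝ inertia α) α :=
    ((contDiff_inertia (n := 1)).differentiable (by simp) α).hasFDerivAt
  have h3 := h1.fun_mul ((hasDerivAt_inv (inertia_ne_zero α)).comp_hasFDerivAt α h2)
  have h4 : (fun x => F x i) = fun x => -Ftilde x i * (Inv.inv ∘ inertia) x := by
    ext x
    simp [F, div_eq_mul_inv]
  have hI := inertia_ne_zero α
  rw [grad, partialD, h4, h3.fderiv, partialD, partialD]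
  simp
  field_simp
  ring

lemma curl_F (α : Fin 3 → ℝ) : curl F α =
    (inertia α ^ 2)⁻¹ • (crossProduct (grad inertia α) (Ftilde α) - inertia α • curl Ftilde α) := by
  have hI := inertia_ne_zero α
  unfold curl
  simp only [partialD_F, cross_apply]
  ext j
  fin_cases j <;> simp <;> field_simp <;> ring

lemma inertia_sq_mul_magneticField (α : Fin 3 → ℝ) : inertia α ^ 2 * magneticField α =
    (crossProduct (grad inertia α) (Ftilde α) - inertia α • curl Ftilde α) ⬝ᵥ
      grad constraint α := by
  rw [magneticField, curl_F, smul_dotProduct, smul_eq_mul, mul_inv_cancel_left₀]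
  exact pow_ne_zero 2 (inertia_ne_zero α)

lemma magneticField_formula (α : Fin 3 → ℝ) :
    5 / 8 * inertia α ^ 2 * magneticField α =
        Real.cos (3 * α 2) * (Real.cos (α 0) + Real.cos (α 1))
        + Real.cos (2 * α 2) * (3 + 2 * Real.cos (α 0 - α 1) + Real.cos (α 0 + α 1))
        + Real.cos (α 2) * (Real.cos (α 0) + Real.cos (α 1) - Real.cos (3 * α 1)
            - Real.cos (2 * α 0 - α 1) - 2 * Real.cos (α 0 + 2 * α 1))
        + Real.sin (α 0) * Real.sin (α 1)
        - Real.cos (α 0) * (2 * Real.cos (α 1) + Real.cos (3 * α 1))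
        - Real.cos (2 * α 0) - 2 * Real.cos (2 * α 1) := by
  have q0 := Real.sin_sq_add_cos_sq (α 0)
  have q1 := Real.sin_sq_add_cos_sq (α 1)
  have q2 := Real.sin_sq_add_cos_sq (α 2)
  rw [mul_assoc, inertia_sq_mul_magneticField, grad_inertia, curl_Ftilde, grad_constraint]
  simp only [Ftilde, cross_apply, inertia, dotProduct, Fin.sum_univ_three, Pi.sub_apply,
    Pi.smul_apply, Matrix.cons_val, smul_eq_mul, Real.cos_three_mul, Real.cos_sub, Real.cos_add,
    Real.cos_two_mul, Real.sin_two_mul]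
  generalize Real.cos (α 0) = c0 at *
  generalize Real.cos (α 1) = c1 at *
  generalize Real.cos (α 2) = c2 at *
  generalize Real.sin (α 0) = s0 at *
  generalize Real.sin (α 1) = s1 at *
  generalize Real.sin (α 2) = s2 at *
  grind

lemma grad_constraint_ne_zero {α : Fin 3 → ℝ} (h : constraint α = 0) :
    grad constraint α ≠ 0 := by
  rw [grad_constraint]
  intro h0
  have e0 := congrFun h0 0
  have e1 := congrFun h0 1
  have e2 := congrFun h0 2
  simp only [Matrix.cons_val, Pi.zero_apply] at e0 e1 e2
  have q0 := Real.sin_sq_add_cos_sq (α 0)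
  have q1 := Real.sin_sq_add_cos_sq (α 1)
  have q2 := Real.sin_sq_add_cos_sq (α 2)
  simp only [constraint] at h
  grind

/-! ### Surfaces in the constraint surface -/

lemma grad_dotProduct (f : (Fin 3 → ℝ) → ℝ) (α v : Fin 3 → ℝ) :
    grad f α ⬝ᵥ v = fderiv ℝ f α v := by
  conv_rhs => rw [← Finset.univ_sum_single v]
  rw [map_sum, dotProduct]
  refine Finset.sum_congr rfl fun j _ => ?_
  rw [grad, partialD, show (Pi.single j (v j) : Fin 3 → ℝ) = v j • Pi.single j 1 by
    rw [← Pi.single_smul, smul_eq_mul, mul_one], map_smul, smul_eq_mul, mul_comm]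

lemma dotProduct_self_pos {v : Fin 3 → ℝ} (hv : v ≠ 0) : 0 < v ⬝ᵥ v :=
  lt_of_le_of_ne (Finset.sum_nonneg fun _ _ => mul_self_nonneg _)
    fun h => hv (dotProduct_self_eq_zero.1 h.symm)

lemma len_pos {v : Fin 3 → ℝ} (hv : v ≠ 0) : 0 < len v := Real.sqrt_pos.2 (dotProduct_self_pos hv)

lemma len_smul (c : ℝ) (v : Fin 3 → ℝ) : len (c • v) = |c| * len v := by
  rw [len, len, smul_dotProduct, dotProduct_smul, smul_eq_mul, smul_eq_mul, ← mul_assoc,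
    Real.sqrt_mul (mul_self_nonneg c), Real.sqrt_mul_self_eq_abs]

/-- A cross product of two vectors orthogonal to `g ≠ 0` is a multiple of `g`. -/
lemma cross_eq_smul_of_orthogonal {g v w : Fin 3 → ℝ} (hg : g ≠ 0) (hv : g ⬝ᵥ v = 0)
    (hw : g ⬝ᵥ w = 0) : crossProduct v w = (crossProduct v w ⬝ᵥ g / g ⬝ᵥ g) • g := by
  have h := dotProduct_self_pos hg
  rw [div_eq_inv_mul, mul_smul, eq_inv_smul_iff₀ h.ne']
  simp only [dotProduct, Fin.sum_univ_three] at hv hw ⊢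
  ext i
  fin_cases i <;> simp [cross_apply]
  · linear_combination (g 1 * w 2 - g 2 * w 1) * hv - (g 1 * v 2 - g 2 * v 1) * hw
  · linear_combination (g 2 * w 0 - g 0 * w 2) * hv - (g 2 * v 0 - g 0 * v 2) * hw
  · linear_combination (g 0 * w 1 - g 1 * w 0) * hv - (g 0 * v 1 - g 1 * v 0) * hw

/-- The velocity of a map into the constraint surface is orthogonal to the gradient. -/
lemma grad_constraint_dotProduct_fderiv {σ : ℝ × ℝ → Fin 3 → ℝ} {x : ℝ × ℝ}
    (hσ : DifferentiableAt ℝ σ x) (h : ∀ᶠ y in nhds x, constraint (σ y) = 0) (v : ℝ × ℝ) :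
    grad constraint (σ x) ⬝ᵥ fderiv ℝ σ x v = 0 := by
  have h1 : HasFDerivAt (fun y => constraint (σ y))
      ((fderiv ℝ constraint (σ x)).comp (fderiv ℝ σ x)) x :=
    ((contDiff_constraint (n := 1)).differentiable (by simp) _).hasFDerivAt.comp x hσ.hasFDerivAt
  have h2 : HasFDerivAt (fun y => constraint (σ y)) (0 : ℝ × ℝ →L[ℝ] ℝ) x :=
    (hasFDerivAt_const (0 : ℝ) x).congr_of_eventuallyEq h
  rw [grad_dotProduct, ← ContinuousLinearMap.comp_apply, h1.unique h2]
  rfl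

lemma graph_flux {a : ℝ × ℝ → ℝ} {x : ℝ × ℝ} (ha : DifferentiableAt ℝ a x)
    (h : ∀ᶠ y in nhds x, constraint ![y.1, y.2, a y] = 0)
    (h3 : partialD constraint 2 ![x.1, x.2, a x] ≠ 0) :
    curl F ![x.1, x.2, a x] ⬝ᵥ normalVec (fun y => ![y.1, y.2, a y]) x =
        magneticField ![x.1, x.2, a x] / partialD constraint 2 ![x.1, x.2, a x] ∧
      len (normalVec (fun y => ![y.1, y.2, a y]) x) =
        len (grad constraint ![x.1, x.2, a x]) /
          |partialD constraint 2 ![x.1, x.2, a x]| := by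
  set σ : ℝ × ℝ → Fin 3 → ℝ := fun y => ![y.1, y.2, a y]
  have hσ : HasFDerivAt σ (ContinuousLinearMap.pi ![ContinuousLinearMap.fst ℝ ℝ ℝ,
      ContinuousLinearMap.snd ℝ ℝ ℝ, fderiv ℝ a x]) x := by
    rw [hasFDerivAt_pi]
    intro i
    fin_cases i
    · exact hasFDerivAt_fst
    · exact hasFDerivAt_snd
    · exact ha.hasFDerivAt
  have hg : grad constraint (σ x) ≠ 0 := grad_constraint_ne_zero h.self_of_nhds
  have h10 := grad_constraint_dotProduct_fderiv hσ.differentiableAt h (1, 0)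
  have h01 := grad_constraint_dotProduct_fderiv hσ.differentiableAt h (0, 1)
  have hn : normalVec σ x = (partialD constraint 2 (σ x))⁻¹ • grad constraint (σ x) := by
    rw [eq_inv_smul_iff₀ h3]
    rw [hσ.fderiv] at h10 h01
    rw [normalVec, hσ.fderiv]
    simp only [dotProduct, Fin.sum_univ_three] at h10 h01
    simp at h10 h01
    change grad constraint (σ x) 2 • _ = _
    ext i
    fin_cases i <;> simp [cross_apply]
    · linear_combination -h10
    · linear_combination -h01
  change curl F (σ x) ⬝ᵥ normalVec σ x = magneticField (σ x) / _ ∧ len (normalVec σ x) = _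
  rw [hn]
  refine ⟨?_, ?_⟩
  · rw [dotProduct_smul, smul_eq_mul, magneticField, inv_mul_eq_div]
  · rw [len_smul, abs_inv, inv_mul_eq_div]

/-! ### Motions with zero angular momentum -/

/-- The rate of rotation at zero angular momentum. -/
def rotationRate (α : ℝ → Fin 3 → ℝ) (t : ℝ) : ℝ := F (α t) ⬝ᵥ derivWithin α (Icc 0 1) t

lemma continuousOn_rotationRate {α : ℝ → Fin 3 → ℝ} (hα : ContDiffOn ℝ 1 α (Icc 0 1)) :
    ContinuousOn (rotationRate α) (Icc 0 1) := by
  have h1 : ContinuousOn (derivWithin α (Icc 0 1)) (Icc 0 1) :=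
    hα.continuousOn_derivWithin (uniqueDiffOn_Icc zero_lt_one) le_rfl
  have h2 : ContinuousOn (fun t => F (α t)) (Icc 0 1) :=
    (contDiff_F (n := 1)).continuous.comp_continuousOn hα.continuousOn
  rw [continuousOn_pi] at h1 h2
  unfold rotationRate dotProduct
  exact continuousOn_finsetSum _ fun i _ => (h2 i).mul (h1 i)

lemma zeroMomentum_iff {θ : ℝ → ℝ} {α : ℝ → Fin 3 → ℝ} (hα : ContDiffOn ℝ 1 α (Icc 0 1)) :
    ZeroMomentum θ α ↔
      ∀ t ∈ Icc (0 : ℝ) 1, HasDerivWithinAt θ (rotationRate α t) (Icc 0 1) t := by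
  have key : ∀ t ∈ Icc (0 : ℝ) 1, DifferentiableWithinAt ℝ θ (Icc 0 1) t →
      (angularMomentum (Icc 0 1) (fun τ => vertices (θ τ) (α τ)) t = 0 ↔
        derivWithin θ (Icc 0 1) t = rotationRate α t) := by
    intro t ht hθ
    rw [angularMomentum_vertices (uniqueDiffOn_Icc zero_lt_one t ht) hθ
      (hα.differentiableOn (by simp) t ht)]
    have hI := inertia_ne_zero (α t)
    have hF : rotationRate α t =
        -(Ftilde (α t) ⬝ᵥ derivWithin α (Icc 0 1) t) / inertia (α t) := by
      simp only [rotationRate, F, dotProduct, Fin.sum_univ_three]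
      ring
    rw [hF, eq_div_iff hI]
    constructor <;> intro h <;> linarith
  constructor
  · rintro ⟨h1, h2⟩ t ht
    rw [← (key t ht (h1 t ht)).1 (h2 t ht)]
    exact (h1 t ht).hasDerivWithinAt
  · intro h
    have h1 : DifferentiableOn ℝ θ (Icc 0 1) := fun t ht => (h t ht).differentiableWithinAt
    exact ⟨h1, fun t ht => (key t ht (h1 t ht)).2
      ((h t ht).derivWithin (uniqueDiffOn_Icc zero_lt_one t ht))⟩

lemma exists_zeroMomentum {α : ℝ → Fin 3 → ℝ} (hα : ContDiffOn ℝ 1 α (Icc 0 1)) (θ₀ : ℝ) :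
    ∃ θ : ℝ → ℝ, θ 0 = θ₀ ∧ ZeroMomentum θ α := by
  have hg : Continuous (fun t => rotationRate α (projIcc (0 : ℝ) 1 zero_le_one t)) :=
    (continuousOn_rotationRate hα).comp_continuous
      (continuous_subtype_val.comp continuous_projIcc) fun t => Subtype.coe_prop _
  refine ⟨fun t => θ₀ + ∫ τ in (0 : ℝ)..t, rotationRate α (projIcc (0 : ℝ) 1 zero_le_one τ),
    by simp, ?_⟩
  rw [zeroMomentum_iff hα]
  intro t ht
  have h := ((hg.integral_hasStrictDerivAt 0 t).hasDerivAt.const_add θ₀).hasDerivWithinAt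
    (s := Icc 0 1)
  rwa [projIcc_of_mem zero_le_one ht] at h

lemma rotation_eq_lineIntegral {θ : ℝ → ℝ} {α : ℝ → Fin 3 → ℝ} (hα : ContDiffOn ℝ 1 α (Icc 0 1))
    (hθ : ZeroMomentum θ α) : θ 1 - θ 0 = lineIntegral F α := by
  rw [zeroMomentum_iff hα] at hθ
  have h1 : ContinuousOn θ (Icc 0 1) := fun t ht => (hθ t ht).continuousWithinAt
  refine (intervalIntegral.integral_eq_sub_of_hasDerivAt_of_le zero_le_one h1
    (f' := rotationRate α) (fun t ht => ?_) ?_).symm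
  · exact (hθ t (Ioo_subset_Icc_self ht)).hasDerivAt (Icc_mem_nhds ht.1 ht.2)
  · refine ContinuousOn.intervalIntegrable ?_
    rw [uIcc_of_le zero_le_one]
    exact continuousOn_rotationRate hα

/-! ### Stokes' theorem for discs in polar parameters -/

section Stokes

/-- The closed parameter square. -/
def closedSquare : Set (ℝ × ℝ) := Icc 0 1 ×ˢ Icc 0 1

lemma closedSquare_eq_Icc : closedSquare = Icc (0, 0) (1, 1) := by
  rw [closedSquare, Icc_prod_eq]

lemma isCompact_closedSquare : IsCompact closedSquare := isCompact_Icc.prod isCompact_Icc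

lemma isOpen_square : IsOpen square := isOpen_Ioo.prod isOpen_Ioo

lemma square_subset : square ⊆ closedSquare := prod_mono Ioo_subset_Icc_self Ioo_subset_Icc_self

lemma closedSquare_mem_nhds {x : ℝ × ℝ} (hx : x ∈ square) : closedSquare ∈ nhds x :=
  Filter.mem_of_superset (isOpen_square.mem_nhds hx) square_subset

lemma uniqueDiffOn_closedSquare : UniqueDiffOn ℝ closedSquare :=
  (uniqueDiffOn_Icc zero_lt_one).prod (uniqueDiffOn_Icc zero_lt_one)

lemma square_ae_eq : (square : Set (ℝ × ℝ)) =ᵐ[volume] closedSquare :=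
  Measure.set_prod_ae_eq Ioo_ae_eq_Icc Ioo_ae_eq_Icc

variable {σ : ℝ × ℝ → Fin 3 → ℝ}

lemma hasDerivWithinAt_snd (hσ : DifferentiableOn ℝ σ closedSquare) {s t : ℝ}
    (hs : s ∈ Icc (0 : ℝ) 1) (ht : t ∈ Icc (0 : ℝ) 1) :
    HasDerivWithinAt (fun τ => σ (s, τ)) (fderivWithin ℝ σ closedSquare (s, t) (0, 1))
      (Icc 0 1) t := by
  have h1 := (hσ (s, t) ⟨hs, ht⟩).hasFDerivWithinAt
  have h2 : HasDerivWithinAt (fun τ : ℝ => (s, τ)) ((0 : ℝ), (1 : ℝ)) (Icc 0 1) t :=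
    ((hasDerivAt_const t s).prodMk (hasDerivAt_id t)).hasDerivWithinAt
  exact h1.comp_hasDerivWithinAt t h2 fun τ hτ => ⟨hs, hτ⟩

lemma hasDerivWithinAt_fst (hσ : DifferentiableOn ℝ σ closedSquare) {s t : ℝ}
    (hs : s ∈ Icc (0 : ℝ) 1) (ht : t ∈ Icc (0 : ℝ) 1) :
    HasDerivWithinAt (fun τ => σ (τ, t)) (fderivWithin ℝ σ closedSquare (s, t) (1, 0))
      (Icc 0 1) s := by
  have h1 := (hσ (s, t) ⟨hs, ht⟩).hasFDerivWithinAt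
  have h2 : HasDerivWithinAt (fun τ : ℝ => (τ, t)) ((1 : ℝ), (0 : ℝ)) (Icc 0 1) s :=
    ((hasDerivAt_id s).prodMk (hasDerivAt_const s t)).hasDerivWithinAt
  exact HasFDerivWithinAt.comp_hasDerivWithinAt (f := fun τ : ℝ => (τ, t)) (t := closedSquare) s h1
    h2 fun τ hτ => ⟨hτ, ht⟩

lemma fderiv_dotProduct_sub {G : (Fin 3 → ℝ) → Fin 3 → ℝ} {p : Fin 3 → ℝ}
    (hG : DifferentiableAt ℝ G p) (v w : Fin 3 → ℝ) :
    fderiv ℝ G p v ⬝ᵥ w - fderiv ℝ G p w ⬝ᵥ v = curl G p ⬝ᵥ crossProduct v w := by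
  have h : ∀ i u, fderiv ℝ G p u i = grad (fun x => G x i) p ⬝ᵥ u := by
    intro i u
    rw [grad_dotProduct, (hasFDerivAt_pi'.1 hG.hasFDerivAt i).fderiv]
    rfl
  simp only [dotProduct, Fin.sum_univ_three, h, curl, grad, cross_apply, Matrix.cons_val]
  ring

lemma hasFDerivAt_dotProduct {u v : ℝ × ℝ → Fin 3 → ℝ} {u' v' : ℝ × ℝ →L[ℝ] Fin 3 → ℝ}
    {x : ℝ × ℝ} (hu : HasFDerivAt u u' x) (hv : HasFDerivAt v v' x) :
    ∃ L : ℝ × ℝ →L[ℝ] ℝ, HasFDerivAt (fun y => u y ⬝ᵥ v y) L x ∧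
      ∀ h, L h = u' h ⬝ᵥ v x + u x ⬝ᵥ v' h := by
  refine ⟨_, HasFDerivAt.fun_sum fun i _ =>
    (hasFDerivAt_pi'.1 hu i).fun_mul (hasFDerivAt_pi'.1 hv i), fun h => ?_⟩
  simp only [dotProduct, sum_apply, ← Finset.sum_add_distrib]
  refine Finset.sum_congr rfl fun i _ => ?_
  simp
  ring

lemma contDiffAt_of_mem_square (hσ : ContDiffOn ℝ 2 σ closedSquare) {x : ℝ × ℝ}
    (hx : x ∈ square) : ContDiffAt ℝ 2 σ x := hσ.contDiffAt (closedSquare_mem_nhds hx)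

lemma fderivWithin_eventuallyEq {x : ℝ × ℝ} (hx : x ∈ square) :
    fderivWithin ℝ σ closedSquare =ᶠ[nhds x] fderiv ℝ σ := by
  filter_upwards [isOpen_square.mem_nhds hx] with y hy
  exact fderivWithin_of_mem_nhds (closedSquare_mem_nhds hy)

/-- The integrand of the divergence theorem. -/
lemma divergence_eq_curl {G : (Fin 3 → ℝ) → Fin 3 → ℝ} (hG : ContDiff ℝ 1 G)
    (hσ : ContDiffOn ℝ 2 σ closedSquare) {x : ℝ × ℝ} (hx : x ∈ square) :
    ∃ L M : ℝ × ℝ →L[ℝ] ℝ,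
      HasFDerivAt (fun y => G (σ y) ⬝ᵥ fderivWithin ℝ σ closedSquare y (0, 1)) L x ∧
      HasFDerivAt (fun y => -(G (σ y) ⬝ᵥ fderivWithin ℝ σ closedSquare y (1, 0))) M x ∧
      L (1, 0) + M (0, 1) = curl G (σ x) ⬝ᵥ normalVec σ x := by
  have h2 := contDiffAt_of_mem_square hσ hx
  have hd : HasFDerivAt (fderiv ℝ σ) (fderiv ℝ (fderiv ℝ σ) x) x :=
    ((h2.fderiv_right (m := 1) le_rfl).differentiableAt (by simp)).hasFDerivAt
  have hd' := hd.congr_of_eventuallyEq (fderivWithin_eventuallyEq hx)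
  have hGd : DifferentiableAt ℝ G (σ x) := hG.differentiable (by simp) _
  have hGσ : HasFDerivAt (fun y => G (σ y)) ((fderiv ℝ G (σ x)).comp (fderiv ℝ σ x)) x :=
    hGd.hasFDerivAt.comp x (h2.differentiableAt (by simp)).hasFDerivAt
  have hv : ∀ v : ℝ × ℝ, HasFDerivAt (fun y => fderivWithin ℝ σ closedSquare y v)
      ((fderiv ℝ (fderiv ℝ σ) x).flip v) x := fun v =>
    (hd'.clm_apply (hasFDerivAt_const v x)).congr_fderiv (by ext <;> simp)
  obtain ⟨L, hL, hL'⟩ := hasFDerivAt_dotProduct hGσ (hv (0, 1))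
  obtain ⟨M, hM, hM'⟩ := hasFDerivAt_dotProduct hGσ (hv (1, 0))
  refine ⟨L, -M, hL, hM.neg, ?_⟩
  have hsymm : fderiv ℝ (fderiv ℝ σ) x (1, 0) (0, 1) = fderiv ℝ (fderiv ℝ σ) x (0, 1) (1, 0) :=
    (h2.isSymmSndFDerivAt (by simp)) (1, 0) (0, 1)
  have hx' := (fderivWithin_eventuallyEq (σ := σ) hx).self_of_nhds
  rw [neg_apply, hL', hM', normalVec, ← fderiv_dotProduct_sub hGd]
  simp only [hx', ContinuousLinearMap.flip_apply, ContinuousLinearMap.comp_apply, hsymm]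
  ring

lemma continuousOn_curl_dotProduct {G : (Fin 3 → ℝ) → Fin 3 → ℝ} (hG : ContDiff ℝ 1 G)
    (hσ : ContDiffOn ℝ 2 σ closedSquare) :
    ContinuousOn (fun x => curl G (σ x) ⬝ᵥ
      crossProduct (fderivWithin ℝ σ closedSquare x (1, 0))
        (fderivWithin ℝ σ closedSquare x (0, 1))) closedSquare := by
  have h1 : ContinuousOn (fderivWithin ℝ σ closedSquare) closedSquare :=
    hσ.continuousOn_fderivWithin uniqueDiffOn_closedSquare (by simp)
  have hv : ∀ v : ℝ × ℝ, ∀ i,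
      ContinuousOn (fun y => fderivWithin ℝ σ closedSquare y v i) closedSquare := fun v =>
    continuousOn_pi.1 (h1.clm_apply continuousOn_const)
  have hp : ∀ i j, ContinuousOn (fun y => partialD (fun x => G x i) j (σ y)) closedSquare := by
    intro i j
    have h2 : Continuous (partialD (fun x => G x i) j) :=
      ((contDiff_pi.1 hG i).continuous_fderiv (by simp)).clm_apply continuous_const
    exact h2.comp_continuousOn hσ.continuousOn
  simp only [dotProduct, Fin.sum_univ_three, curl, cross_apply, Matrix.cons_val]
  fun_prop

lemma integrableOn_curl {G : (Fin 3 → ℝ) → Fin 3 → ℝ} (hG : ContDiff ℝ 1 G)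
    (hσ : ContDiffOn ℝ 2 σ closedSquare) :
    IntegrableOn (fun x => curl G (σ x) ⬝ᵥ normalVec σ x) square := by
  refine IntegrableOn.congr_fun (((continuousOn_curl_dotProduct hG hσ).integrableOn_compact
    isCompact_closedSquare).mono_set square_subset) (fun x hx => ?_) isOpen_square.measurableSet
  simp only [normalVec, (fderivWithin_eventuallyEq (σ := σ) hx).self_of_nhds]

/-- Stokes' theorem for a disc in polar parameters. -/
lemma flux_curl_eq_lineIntegral {G : (Fin 3 → ℝ) → Fin 3 → ℝ} (hG : ContDiff ℝ 1 G)
    {α : ℝ → Fin 3 → ℝ} (hσ : IsSpanningDisc α σ) : flux (curl G) σ = lineIntegral G α := by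
  have hσ2 : ContDiffOn ℝ 2 σ closedSquare := hσ.contDiffOn
  have hσd : DifferentiableOn ℝ σ closedSquare := hσ2.differentiableOn (by simp)
  set f := fun y => G (σ y) ⬝ᵥ fderivWithin ℝ σ closedSquare y (0, 1) with hf
  set g := fun y => -(G (σ y) ⬝ᵥ fderivWithin ℝ σ closedSquare y (1, 0)) with hg
  have h0 : (0 : ℝ) ∈ Icc (0 : ℝ) 1 := ⟨le_rfl, zero_le_one⟩
  have h1 : (1 : ℝ) ∈ Icc (0 : ℝ) 1 := ⟨zero_le_one, le_rfl⟩
  have hu : ∀ t ∈ Icc (0 : ℝ) 1, UniqueDiffWithinAt ℝ (Icc (0 : ℝ) 1) t :=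
    uniqueDiffOn_Icc zero_lt_one
  have hD : ContinuousOn (fderivWithin ℝ σ closedSquare) closedSquare :=
    hσ2.continuousOn_fderivWithin uniqueDiffOn_closedSquare (by simp)
  have hGσ : ContinuousOn (fun y => G (σ y)) closedSquare :=
    hG.continuous.comp_continuousOn hσ2.continuousOn
  have hc : ∀ v : ℝ × ℝ, ContinuousOn
      (fun y => G (σ y) ⬝ᵥ fderivWithin ℝ σ closedSquare y v) closedSquare := fun v =>
    continuousOn_finsetSum _ fun i _ => (continuousOn_pi.1 hGσ i).mul
      (continuousOn_pi.1 (hD.clm_apply continuousOn_const) i)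
  have hdiv : ∀ x ∈ square, fderiv ℝ f x (1, 0) + fderiv ℝ g x (0, 1) =
      curl G (σ x) ⬝ᵥ normalVec σ x := by
    intro x hx
    obtain ⟨L, M, hL, hM, h⟩ := divergence_eq_curl hG hσ2 hx
    rw [hL.fderiv, hM.fderiv, h]
  have hint : IntegrableOn (fun x => fderiv ℝ f x (1, 0) + fderiv ℝ g x (0, 1)) closedSquare :=
    (IntegrableOn.congr_fun (integrableOn_curl hG hσ2) (fun x hx => (hdiv x hx).symm)
      isOpen_square.measurableSet).congr_set_ae square_ae_eq.symm
  have key := integral_divergence_prod_Icc_of_hasFDerivAt_of_le f g (fderiv ℝ f) (fderiv ℝ g)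
    (0, 0) (1, 1) ⟨zero_le_one, zero_le_one⟩ (closedSquare_eq_Icc ▸ hc _)
    (closedSquare_eq_Icc ▸ (hc _).neg)
    (fun x hx => by
      obtain ⟨L, M, hL, hM, h⟩ := divergence_eq_curl hG hσ2 hx
      exact hL.differentiableAt.hasFDerivAt)
    (fun x hx => by
      obtain ⟨L, M, hL, hM, h⟩ := divergence_eq_curl hG hσ2 hx
      exact hM.differentiableAt.hasFDerivAt)
    (closedSquare_eq_Icc ▸ hint)
  rw [← closedSquare_eq_Icc, ← setIntegral_congr_set square_ae_eq,
    setIntegral_congr_fun isOpen_square.measurableSet hdiv] at key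
  rw [flux, key]
  have b1 : ∀ t ∈ Icc (0 : ℝ) 1, f (1, t) = G (α t) ⬝ᵥ derivWithin α (Icc 0 1) t := by
    intro t ht
    rw [hf, ← hσ.boundary t ht]
    beta_reduce
    rw [← (hasDerivWithinAt_snd hσd h1 ht).derivWithin (hu t ht),
      derivWithin_congr (fun τ hτ => hσ.boundary τ hτ) (hσ.boundary t ht)]
  have b0 : ∀ t ∈ Icc (0 : ℝ) 1, f (0, t) = 0 := by
    intro t ht
    have : fderivWithin ℝ σ closedSquare (0, t) (0, 1) = 0 := by
      rw [← (hasDerivWithinAt_snd hσd h0 ht).derivWithin (hu t ht),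
        derivWithin_congr (fun τ hτ => hσ.centre τ hτ) (hσ.centre t ht)]
      simp
    simp [hf, this]
  have bs : ∀ s ∈ Icc (0 : ℝ) 1, g (s, 1) = g (s, 0) := by
    intro s hs
    simp only [hg]
    rw [← (hasDerivWithinAt_fst hσd hs h1).derivWithin (hu s hs),
      ← (hasDerivWithinAt_fst hσd hs h0).derivWithin (hu s hs), hσ.seam s hs,
      derivWithin_congr (fun τ hτ => hσ.seam τ hτ) (hσ.seam s hs)]
  rw [← uIcc_of_le zero_le_one] at b1 b0 bs
  rw [intervalIntegral.integral_congr bs, intervalIntegral.integral_congr b1,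
    intervalIntegral.integral_congr b0, lineIntegral]
  simp

end Stokes

/-! ### The flux as an integral of the magnetic field -/

section Flux

/-- The factor between the normal vector of a surface in `C = 0` and the gradient of `C`. -/
def normalFactor (σ : ℝ × ℝ → Fin 3 → ℝ) (x : ℝ × ℝ) : ℝ :=
  normalVec σ x ⬝ᵥ grad constraint (σ x) / grad constraint (σ x) ⬝ᵥ grad constraint (σ x)

variable {σ : ℝ × ℝ → Fin 3 → ℝ}

lemma normalVec_eq_smul (hσ : ContDiffOn ℝ 2 σ closedSquare)
    (hC : ∀ x ∈ closedSquare, constraint (σ x) = 0) {x : ℝ × ℝ} (hx : x ∈ square) :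
    normalVec σ x = normalFactor σ x • grad constraint (σ x) := by
  have hd : DifferentiableAt ℝ σ x := (contDiffAt_of_mem_square hσ hx).differentiableAt (by simp)
  have he : ∀ᶠ y in nhds x, constraint (σ y) = 0 := by
    filter_upwards [closedSquare_mem_nhds hx] with y hy using hC y hy
  exact cross_eq_smul_of_orthogonal (grad_constraint_ne_zero (hC x (square_subset hx)))
    (grad_constraint_dotProduct_fderiv hd he _) (grad_constraint_dotProduct_fderiv hd he _)

lemma curl_dotProduct_normalVec (hσ : ContDiffOn ℝ 2 σ closedSquare)
    (hC : ∀ x ∈ closedSquare, constraint (σ x) = 0) {x : ℝ × ℝ} (hx : x ∈ square) :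
    curl F (σ x) ⬝ᵥ normalVec σ x = normalFactor σ x * magneticField (σ x) := by
  rw [normalVec_eq_smul hσ hC hx, dotProduct_smul, smul_eq_mul, magneticField]

lemma continuousOn_normalFactor (hσ : ContDiffOn ℝ 2 σ closedSquare)
    (hC : ∀ x ∈ closedSquare, constraint (σ x) = 0) : ContinuousOn (normalFactor σ) square := by
  have h1 : ContinuousOn (fderiv ℝ σ) square := fun x hx =>
    (((contDiffAt_of_mem_square hσ hx).fderiv_right (m := 1) le_rfl).continuousAt).continuousWithinAt
  have hv : ∀ v : ℝ × ℝ, ∀ i, ContinuousOn (fun y => fderiv ℝ σ y v i) square := fun v =>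
    continuousOn_pi.1 (h1.clm_apply continuousOn_const)
  have hg : ∀ i, ContinuousOn (fun y => grad constraint (σ y) i) square := by
    intro i
    have h2 : Continuous (partialD constraint i) :=
      ((contDiff_constraint (n := 1)).continuous_fderiv (by simp)).clm_apply continuous_const
    exact h2.comp_continuousOn (hσ.continuousOn.mono square_subset)
  have hne : ∀ x ∈ square, grad constraint (σ x) ⬝ᵥ grad constraint (σ x) ≠ 0 := fun x hx =>
    (dotProduct_self_pos (grad_constraint_ne_zero (hC x (square_subset hx)))).ne'
  unfold normalFactor
  simp only [dotProduct, Fin.sum_univ_three, normalVec, cross_apply, Matrix.cons_val] at hne ⊢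
  refine ContinuousOn.div ?_ ?_ hne <;> fun_prop

/-- A regular surface in `C = 0` has a constant orientation relative to the gradient of `C`. -/
lemma exists_orientation (hσ : ContDiffOn ℝ 2 σ closedSquare)
    (hC : ∀ x ∈ closedSquare, constraint (σ x) = 0) (hn : ∀ x ∈ square, normalVec σ x ≠ 0) :
    ∃ ε : ℝ, (ε = 1 ∨ ε = -1) ∧ ∀ x ∈ square,
      normalFactor σ x = ε * len (normalVec σ x) / len (grad constraint (σ x)) := by
  have h0 : ∀ x ∈ square, normalFactor σ x ≠ 0 := by
    intro x hx h
    refine hn x hx ?_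
    rw [normalVec_eq_smul hσ hC hx, h, zero_smul]
  have habs : ∀ x ∈ square,
      |normalFactor σ x| = len (normalVec σ x) / len (grad constraint (σ x)) := by
    intro x hx
    rw [normalVec_eq_smul hσ hC hx, len_smul, mul_div_cancel_right₀]
    exact (len_pos (grad_constraint_ne_zero (hC x (square_subset hx)))).ne'
  have hpre : IsPreconnected (square : Set (ℝ × ℝ)) := isPreconnected_Ioo.prod isPreconnected_Ioo
  have hc := continuousOn_normalFactor hσ hC
  by_cases hpos : ∀ x ∈ square, 0 < normalFactor σ x
  · refine ⟨1, Or.inl rfl, fun x hx => ?_⟩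
    rw [one_mul, ← habs x hx, abs_of_pos (hpos x hx)]
  · push Not at hpos
    obtain ⟨y, hy, hy0⟩ := hpos
    refine ⟨-1, Or.inr rfl, fun x hx => ?_⟩
    rw [neg_one_mul, neg_div, ← habs x hx, abs_of_nonpos, neg_neg]
    by_contra hx0
    push Not at hx0
    obtain ⟨z, hz, hz0⟩ := hpre.intermediate_value hy hx hc ⟨hy0, hx0.le⟩
    exact h0 z hz hz0

/-- The flux through a disc in terms of the magnetic field. -/
lemma flux_curl_eq_integral_magneticField {α : ℝ → Fin 3 → ℝ} (hσ : IsSpanningDisc α σ)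
    {Δ : ℝ} (hΔ : Δ = flux (curl F) σ) :
    IntegrableOn (fun x => curl F (σ x) ⬝ᵥ normalVec σ x) square ∧
    Δ = flux (curl F) σ ∧
    (∃ k : ℝ × ℝ → ℝ,
      (∀ x ∈ square,
        normalVec σ x = k x • grad constraint (σ x) ∧
        curl F (σ x) ⬝ᵥ normalVec σ x = k x * magneticField (σ x) ∧
        (normalVec σ x ≠ 0 → k x ≠ 0)) ∧
      Δ = ∫ x in square, k x * magneticField (σ x)) ∧
    ((∀ x ∈ square, normalVec σ x ≠ 0) →
      ∃ ε : ℝ, (ε = 1 ∨ ε = -1) ∧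
        (∀ x ∈ square, normalVec σ x =
          (ε * len (normalVec σ x) / len (grad constraint (σ x))) •
            grad constraint (σ x)) ∧
        IntegrableOn (fun x => magneticField (σ x) / len (grad constraint (σ x)) *
          len (normalVec σ x)) square ∧
        Δ = ε * areaIntegral (fun y => magneticField y / len (grad constraint y)) σ) := by
  have hσ2 : ContDiffOn ℝ 2 σ closedSquare := hσ.contDiffOn
  have hC : ∀ x ∈ closedSquare, constraint (σ x) = 0 := hσ.mem_surface
  have hi := integrableOn_curl (contDiff_F (n := 1)) hσ2
  have hm := isOpen_square.measurableSet
  refine ⟨hi, hΔ, ⟨normalFactor σ, fun x hx => ⟨normalVec_eq_smul hσ2 hC hx,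
    curl_dotProduct_normalVec hσ2 hC hx, fun hn h => hn ?_⟩, ?_⟩, fun hn => ?_⟩
  · rw [normalVec_eq_smul hσ2 hC hx, h, zero_smul]
  · rw [hΔ, flux]
    exact setIntegral_congr_fun hm fun x hx => curl_dotProduct_normalVec hσ2 hC hx
  · obtain ⟨ε, hε, hk⟩ := exists_orientation hσ2 hC hn
    have hεε : ε * ε = 1 := by rcases hε with rfl | rfl <;> norm_num
    have he : ∀ x ∈ square, curl F (σ x) ⬝ᵥ normalVec σ x =
        ε * (magneticField (σ x) / len (grad constraint (σ x)) * len (normalVec σ x)) := by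
      intro x hx
      rw [curl_dotProduct_normalVec hσ2 hC hx, hk x hx]
      ring
    refine ⟨ε, hε, fun x hx => ?_, ?_, ?_⟩
    · rw [← hk x hx]
      exact normalVec_eq_smul hσ2 hC hx
    · refine IntegrableOn.congr_fun (hi.const_mul ε) (fun x hx => ?_) hm
      simp only [he x hx]
      rw [← mul_assoc, hεε, one_mul]
    · rw [hΔ, flux, areaIntegral, ← integral_const_mul]
      exact setIntegral_congr_fun hm he

end Flux

/-! ### Dihedral symmetry -/

/-- The closed equilateral pentagons with unit edges and centre of mass at the origin. -/
def IsPentagon (z : Fin 5 → ℂ) : Prop := ∑ i, z i = 0 ∧ ∀ i, ‖z (i + 1) - z i‖ = 1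

/-- The edges of a polygon. -/
def edge (z : Fin 5 → ℂ) (i : Fin 5) : ℂ := z (i + 1) - z i

/-- The cosine of the angle between two edges. -/
def edgeDot (z : Fin 5 → ℂ) (i j : Fin 5) : ℝ := (edge z i * starRingEnd ℂ (edge z j)).re

/-- The sine of the angle between two edges. -/
def edgeCross (z : Fin 5 → ℂ) (i j : Fin 5) : ℝ := (edge z i * starRingEnd ℂ (edge z j)).im

/-- The dihedrally symmetric form of the numerator of the magnetic field. -/
def fieldNumerator (z : Fin 5 → ℂ) : ℝ :=
  ∑ i : Fin 5, (3 + edgeDot z i (i + 1) + edgeDot z i (i + 4)) *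
    (2 * (edgeCross z (i + 1) (i + 2) * edgeCross z (i + 3) (i + 4)) +
      edgeCross z (i + 2) (i + 3) * edgeCross z (i + 1) (i + 4))

/-- The magnetic field as a function of the vertices. -/
def vertexField (z : Fin 5 → ℂ) : ℝ := 8 / 25 * fieldNumerator z / (∑ i, ‖z i‖ ^ 2) ^ 2

lemma edgeCross_comm (z : Fin 5 → ℂ) (i j : Fin 5) : edgeCross z i j = -edgeCross z j i := by
  simp [edgeCross]; ring

lemma vertexField_vertexRotation (z : Fin 5 → ℂ) :
    vertexField (vertexRotation z) = vertexField z := by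
  have h1 : ∑ i, ‖vertexRotation z i‖ ^ 2 = ∑ i, ‖z i‖ ^ 2 :=
    Equiv.sum_comp (Equiv.addRight (1 : Fin 5)) fun i => ‖z i‖ ^ 2
  have he : ∀ i, edge (vertexRotation z) i = edge z (i + 1) := fun i => rfl
  have h2 : fieldNumerator (vertexRotation z) = fieldNumerator z := by
    simp only [fieldNumerator, edgeDot, edgeCross, he]
    refine (Finset.sum_congr rfl fun i _ => ?_).trans (Equiv.sum_comp (Equiv.addRight (1 : Fin 5)) _)
    simp only [Equiv.coe_addRight, add_right_comm _ _ (1 : Fin 5)]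
  rw [vertexField, vertexField, h1, h2]

lemma vertexField_vertexReflection (z : Fin 5 → ℂ) :
    vertexField (vertexReflection z) = vertexField z := by
  have h1 : ∑ i, ‖vertexReflection z i‖ ^ 2 = ∑ i, ‖z i‖ ^ 2 :=
    Equiv.sum_comp Fin.revPerm fun i => ‖z i‖ ^ 2
  have he : ∀ i, edge (vertexReflection z) i = -edge z (i + 1).rev := by
    intro i
    simp only [edge, vertexReflection, Equiv.coe_fn_mk, neg_sub]
    congr 2
    revert i; decide
  have hd : ∀ i j, edgeDot (vertexReflection z) i j = edgeDot z (i + 1).rev (j + 1).rev := by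
    intro i j; simp only [edgeDot, he, map_neg, neg_mul_neg]
  have hc : ∀ i j, edgeCross (vertexReflection z) i j = edgeCross z (i + 1).rev (j + 1).rev := by
    intro i j; simp only [edgeCross, he, map_neg, neg_mul_neg]
  have h2 : fieldNumerator (vertexReflection z) = fieldNumerator z := by
    simp only [fieldNumerator, hd, hc]
    refine (Finset.sum_congr rfl fun i _ => ?_).trans
      (Equiv.sum_comp ((Equiv.addRight (1 : Fin 5)).trans Fin.revPerm) _)
    simp only [Equiv.trans_apply, Equiv.coe_addRight, Fin.revPerm_apply]
    have k1 : ∀ i : Fin 5, (i + 1 + 1).rev = (i + 1).rev + 4 := by decide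
    have k2 : ∀ i : Fin 5, (i + 2 + 1).rev = (i + 1).rev + 3 := by decide
    have k3 : ∀ i : Fin 5, (i + 3 + 1).rev = (i + 1).rev + 2 := by decide
    have k4 : ∀ i : Fin 5, (i + 4 + 1).rev = (i + 1).rev + 1 := by decide
    simp only [k1, k2, k3, k4]
    generalize (i + 1).rev = j
    rw [edgeCross_comm z (j + 4) (j + 3), edgeCross_comm z (j + 2) (j + 1),
      edgeCross_comm z (j + 3) (j + 2), edgeCross_comm z (j + 4) (j + 1)]
    ring
  rw [vertexField, vertexField, h1, h2]

lemma vertexField_mirror (z : Fin 5 → ℂ) : vertexField (mirror z) = vertexField z := by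
  have h1 : ∑ i, ‖mirror z i‖ ^ 2 = ∑ i, ‖z i‖ ^ 2 := by simp [mirror]
  have he : ∀ i, edge (mirror z) i = starRingEnd ℂ (edge z i) := fun i => by simp [edge, mirror]
  have hd : ∀ i j, edgeDot (mirror z) i j = edgeDot z i j := by
    intro i j; simp [edgeDot, he]
  have hc : ∀ i j, edgeCross (mirror z) i j = -edgeCross z i j := by
    intro i j; simp [edgeCross, he]; ring
  have h2 : fieldNumerator (mirror z) = fieldNumerator z := by
    simp only [fieldNumerator, hd, hc, neg_mul_neg]
  rw [vertexField, vertexField, h1, h2]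

lemma isPentagon_vertexRotation (z : Fin 5 → ℂ) :
    IsPentagon (vertexRotation z) ↔ IsPentagon z := by
  have h1 : ∑ i, vertexRotation z i = ∑ i, z i := Equiv.sum_comp (Equiv.addRight (1 : Fin 5)) z
  rw [IsPentagon, IsPentagon, h1]
  exact and_congr_right fun _ =>
    (Equiv.addRight (1 : Fin 5)).forall_congr_left (p := fun i => ‖z (i + 1 + 1) - z (i + 1)‖ = 1)
      |>.trans (by simp)

lemma isPentagon_vertexReflection {z : Fin 5 → ℂ} (h : IsPentagon z) :
    IsPentagon (vertexReflection z) := by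
  refine ⟨(Equiv.sum_comp Fin.revPerm z).trans h.1, fun i => ?_⟩
  have k : i.rev = (i + 1).rev + 1 := by revert i; decide
  change ‖z (i + 1).rev - z i.rev‖ = 1
  rw [norm_sub_rev, k]
  exact h.2 _

lemma isPentagon_mirror {z : Fin 5 → ℂ} (h : IsPentagon z) : IsPentagon (mirror z) := by
  refine ⟨?_, fun i => ?_⟩
  · change ∑ i, starRingEnd ℂ (z i) = 0
    rw [← map_sum, h.1, map_zero]
  · change ‖starRingEnd ℂ (z (i + 1)) - starRingEnd ℂ (z i)‖ = 1
    rw [← map_sub, Complex.norm_conj]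
    exact h.2 i

/-- The maps which preserve pentagons and their magnetic field. -/
def IsFieldSymmetry (g : Equiv.Perm (Fin 5 → ℂ)) : Prop :=
  ∀ z, IsPentagon z → IsPentagon (g z) ∧ vertexField (g z) = vertexField z

lemma isFieldSymmetry_of_mem {g : Equiv.Perm (Fin 5 → ℂ)} (hg : g ∈ D10) :
    IsFieldSymmetry g := by
  have hV : vertexReflection⁻¹ = vertexReflection := rfl
  have hM : mirror⁻¹ = mirror := rfl
  have sV : IsFieldSymmetry vertexReflection := fun z hz =>
    ⟨isPentagon_vertexReflection hz, vertexField_vertexReflection z⟩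
  have sM : IsFieldSymmetry mirror := fun z hz => ⟨isPentagon_mirror hz, vertexField_mirror z⟩
  have sR : IsFieldSymmetry vertexRotation := fun z hz =>
    ⟨(isPentagon_vertexRotation z).2 hz, vertexField_vertexRotation z⟩
  have sR' : IsFieldSymmetry vertexRotation⁻¹ := by
    intro z hz
    have hRz : vertexRotation (vertexRotation⁻¹ z) = z := Equiv.apply_symm_apply _ z
    rw [← isPentagon_vertexRotation, ← vertexField_vertexRotation, hRz]
    exact ⟨hz, rfl⟩
  have hmul : ∀ g h : Equiv.Perm (Fin 5 → ℂ), IsFieldSymmetry g → IsFieldSymmetry h →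
      IsFieldSymmetry (g * h) := by
    intro g h sg sh z hz
    have h1 := sh z hz
    have h2 := sg _ h1.1
    exact ⟨h2.1, h2.2.trans h1.2⟩
  refine Subgroup.closure_induction'' (p := fun g _ => IsFieldSymmetry g) ?_ ?_ ?_ ?_ hg
  · rintro x (rfl | rfl | rfl)
    exacts [sR, sV, sM]
  · rintro x (rfl | rfl | rfl)
    exacts [sR', hV ▸ sV, hM ▸ sM]
  · exact fun z hz => ⟨hz, rfl⟩
  · exact fun x y _ _ hx hy => hmul x y hx hy

lemma edge_vertices (θ : ℝ) (α : Fin 3 → ℝ) : edge (vertices θ α) =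
    ![cis θ, cis θ * -cis (edgeAngle α 0), cis θ * cis (edgeAngle α 1),
      cis θ * -cis (edgeAngle α 2),
      cis θ * -(1 - cis (edgeAngle α 0) + cis (edgeAngle α 1) - cis (edgeAngle α 2))] := by
  ext i
  simp only [edge, vertices_eq]
  fin_cases i <;> simp [vertexForm] <;> ring

lemma normSq_closingEdge (α : Fin 3 → ℝ) :
    Complex.normSq (1 - cis (edgeAngle α 0) + cis (edgeAngle α 1) - cis (edgeAngle α 2)) =
      1 + constraint α := by
  have h0 := Real.sin_sq_add_cos_sq (edgeAngle α 0)
  have h1 := Real.sin_sq_add_cos_sq (edgeAngle α 1)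
  have h2 := Real.sin_sq_add_cos_sq (edgeAngle α 2)
  simp only [Complex.normSq_apply, Complex.add_re, Complex.add_im, Complex.sub_re, Complex.sub_im,
    cis_re, cis_im, Complex.one_re, Complex.one_im, constraint]
  linear_combination h0 + h1 + h2 - 2 * cos_edgeAngle_zero α + 2 * cos_edgeAngle_one α
    - 2 * cos_edgeAngle_two α - 2 * dot_edge_zero_one α + 2 * dot_edge_zero_two α
    - 2 * dot_edge_one_two α

lemma sum_vertices (θ : ℝ) (α : Fin 3 → ℝ) : ∑ i, vertices θ α i = 0 := by
  simp [Fin.sum_univ_five, vertices_eq, vertexForm]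
  ring

lemma isPentagon_vertices {θ : ℝ} {α : Fin 3 → ℝ} (h : constraint α = 0) :
    IsPentagon (vertices θ α) := by
  refine ⟨sum_vertices θ α, fun i => ?_⟩
  change ‖edge (vertices θ α) i‖ = 1
  rw [edge_vertices]
  fin_cases i
  · simpa using norm_cis _
  · simp [norm_cis]
  · simp [norm_cis]
  · simp [norm_cis]
  · change ‖_ * -_‖ = 1
    rw [norm_mul, norm_cis, norm_neg, one_mul, ← sq_eq_sq₀ (norm_nonneg _) zero_le_one,
      ← Complex.normSq_eq_norm_sq, normSq_closingEdge, h]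
    norm_num

lemma exists_cis_eq {z : ℂ} (hz : ‖z‖ = 1) : ∃ x : ℝ, cis x = z :=
  ⟨z.arg, by have := Complex.norm_mul_exp_arg_mul_I z; rwa [hz, Complex.ofReal_one, one_mul] at this⟩

lemma eq_of_edge_eq {z w : Fin 5 → ℂ} (hz : ∑ i, z i = 0) (hw : ∑ i, w i = 0)
    (h : ∀ i : Fin 4, edge z i.castSucc = edge w i.castSucc) : z = w := by
  have e0 : z 1 - z 0 = w 1 - w 0 := h 0
  have e1 : z 2 - z 1 = w 2 - w 1 := h 1
  have e2 : z 3 - z 2 = w 3 - w 2 := h 2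
  have e3 : z 4 - z 3 = w 4 - w 3 := h 3
  rw [Fin.sum_univ_five] at hz hw
  ext i
  fin_cases i <;> simp
  · linear_combination (1 / 5 : ℂ) * (hz - hw) - 4 / 5 * e0 - 3 / 5 * e1 - 2 / 5 * e2 - 1 / 5 * e3
  · linear_combination (1 / 5 : ℂ) * (hz - hw) + 1 / 5 * e0 - 3 / 5 * e1 - 2 / 5 * e2 - 1 / 5 * e3
  · linear_combination (1 / 5 : ℂ) * (hz - hw) + 1 / 5 * e0 + 2 / 5 * e1 - 2 / 5 * e2 - 1 / 5 * e3
  · linear_combination (1 / 5 : ℂ) * (hz - hw) + 1 / 5 * e0 + 2 / 5 * e1 + 3 / 5 * e2 - 1 / 5 * e3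
  · linear_combination (1 / 5 : ℂ) * (hz - hw) + 1 / 5 * e0 + 2 / 5 * e1 + 3 / 5 * e2 + 4 / 5 * e3

/-- Every pentagon has an orientation and shape coordinates. -/
lemma IsPentagon.exists_vertices_eq {z : Fin 5 → ℂ} (h : IsPentagon z) :
    ∃ (θ : ℝ) (α : Fin 3 → ℝ), constraint α = 0 ∧ vertices θ α = z := by
  obtain ⟨θ, hθ⟩ := exists_cis_eq (h.2 0)
  have hθ0 : cis θ ≠ 0 := by rw [← norm_ne_zero_iff, norm_cis]; exact one_ne_zero
  have key : ∀ i, ∃ x, cis θ * cis x = edge z i := by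
    intro i
    obtain ⟨x, hx⟩ := exists_cis_eq (z := edge z i / cis θ) (by
      rw [norm_div, norm_cis, div_one]; exact h.2 i)
    exact ⟨x, by rw [hx, mul_div_cancel₀ _ hθ0]⟩
  obtain ⟨A, hA⟩ := key 1
  obtain ⟨B, hB⟩ := key 2
  obtain ⟨D, hD⟩ := key 3
  set α : Fin 3 → ℝ := ![(B + D - A) / 2, (A + D - B) / 2, (A + B - D) / 2]
  have hneg : ∀ x, cis (x - Real.pi) = -cis x := by
    intro x
    apply Complex.ext <;> simp [cis_re, cis_im, Real.cos_sub_pi, Real.sin_sub_pi]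
  have a0 : -cis (edgeAngle α 0) = cis A := by
    simp only [edgeAngle, α, Matrix.cons_val, hneg, neg_neg]; congr 1; ring
  have a1 : cis (edgeAngle α 1) = cis B := by
    simp only [edgeAngle, α, Matrix.cons_val]; congr 1; ring
  have a2 : -cis (edgeAngle α 2) = cis D := by
    simp only [edgeAngle, α, Matrix.cons_val, hneg, neg_neg]; congr 1; ring
  have hv : vertices θ α = z := by
    refine eq_of_edge_eq (sum_vertices θ α) h.1 fun i => ?_
    rw [edge_vertices, a0, a1, a2, hA, hB, hD, hθ]
    fin_cases i <;> rfl
  refine ⟨θ, α, ?_, hv⟩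
  have h4 : ‖edge z 4‖ = 1 := h.2 4
  rw [← hv, edge_vertices] at h4
  change ‖_ * -_‖ = 1 at h4
  rw [norm_mul, norm_cis, norm_neg, one_mul, ← sq_eq_sq₀ (norm_nonneg _) zero_le_one,
    ← Complex.normSq_eq_norm_sq, normSq_closingEdge] at h4
  linarith

/-- The edges of a pentagon in the frame of its first edge. -/
def relEdge (α : Fin 3 → ℝ) : Fin 5 → ℂ :=
  ![1, -cis (edgeAngle α 0), cis (edgeAngle α 1), -cis (edgeAngle α 2),
    -(1 - cis (edgeAngle α 0) + cis (edgeAngle α 1) - cis (edgeAngle α 2))]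

lemma edge_mul_conj_edge (θ : ℝ) (α : Fin 3 → ℝ) (i j : Fin 5) :
    edge (vertices θ α) i * starRingEnd ℂ (edge (vertices θ α) j) =
      relEdge α i * starRingEnd ℂ (relEdge α j) := by
  have h : ∀ i, edge (vertices θ α) i = cis θ * relEdge α i := by
    intro i
    rw [edge_vertices]
    fin_cases i <;> simp [relEdge]
  rw [h, h, map_mul]
  linear_combination relEdge α i * starRingEnd ℂ (relEdge α j) * conj_cis_mul_self θ

lemma sin_edgeAngle_zero (α : Fin 3 → ℝ) : Real.sin (edgeAngle α 0) =
    -(Real.sin (α 1) * Real.cos (α 2) + Real.cos (α 1) * Real.sin (α 2)) := by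
  simp [edgeAngle, Real.sin_sub_pi, Real.sin_add]

lemma sin_edgeAngle_one (α : Fin 3 → ℝ) : Real.sin (edgeAngle α 1) =
    Real.sin (α 0) * Real.cos (α 2) + Real.cos (α 0) * Real.sin (α 2) := by
  simp [edgeAngle, Real.sin_add]

lemma sin_edgeAngle_two (α : Fin 3 → ℝ) : Real.sin (edgeAngle α 2) =
    -(Real.sin (α 0) * Real.cos (α 1) + Real.cos (α 0) * Real.sin (α 1)) := by
  simp [edgeAngle, Real.sin_sub_pi, Real.sin_add]

lemma fieldNumerator_vertices (θ : ℝ) (α : Fin 3 → ℝ) :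
    inertia α ^ 2 * magneticField α = 8 / 25 * fieldNumerator (vertices θ α) +
      24 / 25 * (2 * Real.cos (α 2) ^ 2 - Real.cos (α 0) ^ 2 - Real.cos (α 1) ^ 2)
        * constraint α := by
  have q0 := Real.sin_sq_add_cos_sq (α 0)
  have q1 := Real.sin_sq_add_cos_sq (α 1)
  have q2 := Real.sin_sq_add_cos_sq (α 2)
  rw [inertia_sq_mul_magneticField, grad_inertia, curl_Ftilde, grad_constraint]
  simp only [Ftilde, cross_apply, inertia, dotProduct, Fin.sum_univ_three, Pi.sub_apply,
    Pi.smul_apply, Matrix.cons_val, smul_eq_mul, constraint]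
  have r1 : ∀ i j : Fin 5, edgeDot (vertices θ α) i j =
      (relEdge α i).re * (relEdge α j).re + (relEdge α i).im * (relEdge α j).im := by
    intro i j; simp [edgeDot, edge_mul_conj_edge]
  have r2 : ∀ i j : Fin 5, edgeCross (vertices θ α) i j =
      (relEdge α i).im * (relEdge α j).re - (relEdge α i).re * (relEdge α j).im := by
    intro i j; simp [edgeCross, edge_mul_conj_edge]; ring
  rw [fieldNumerator]
  rw [Fin.sum_univ_five]
  simp only [Fin.reduceAdd, Fin.isValue, zero_add]
  have x0 : (relEdge α 0).re = 1 := rfl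
  have y0 : (relEdge α 0).im = 0 := rfl
  have x1 : (relEdge α 1).re =
      Real.cos (α 1) * Real.cos (α 2) - Real.sin (α 1) * Real.sin (α 2) := by
    simp [relEdge, cis_re, cos_edgeAngle_zero]
  have y1 : (relEdge α 1).im =
      Real.sin (α 1) * Real.cos (α 2) + Real.cos (α 1) * Real.sin (α 2) := by
    simp [relEdge, cis_im, sin_edgeAngle_zero]
  have x2 : (relEdge α 2).re =
      Real.cos (α 0) * Real.cos (α 2) - Real.sin (α 0) * Real.sin (α 2) := by
    simp [relEdge, cis_re, cos_edgeAngle_one]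
  have y2 : (relEdge α 2).im =
      Real.sin (α 0) * Real.cos (α 2) + Real.cos (α 0) * Real.sin (α 2) := by
    simp [relEdge, cis_im, sin_edgeAngle_one]
  have x3 : (relEdge α 3).re =
      Real.cos (α 0) * Real.cos (α 1) - Real.sin (α 0) * Real.sin (α 1) := by
    simp [relEdge, cis_re, cos_edgeAngle_two]
  have y3 : (relEdge α 3).im =
      Real.sin (α 0) * Real.cos (α 1) + Real.cos (α 0) * Real.sin (α 1) := by
    simp [relEdge, cis_im, sin_edgeAngle_two]
  have e4 : relEdge α 4 = -(relEdge α 0 + relEdge α 1 + relEdge α 2 + relEdge α 3) := by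
    simp [relEdge]
    ring
  have x4 : (relEdge α 4).re = -((relEdge α 0).re + (relEdge α 1).re + (relEdge α 2).re
      + (relEdge α 3).re) := by rw [e4]; simp
  have y4 : (relEdge α 4).im = -((relEdge α 0).im + (relEdge α 1).im + (relEdge α 2).im
      + (relEdge α 3).im) := by rw [e4]; simp
  generalize Real.cos (α 0) = c0 at *
  generalize Real.cos (α 1) = c1 at *
  generalize Real.cos (α 2) = c2 at *
  generalize Real.sin (α 0) = s0 at *
  generalize Real.sin (α 1) = s1 at *
  generalize Real.sin (α 2) = s2 at *
  have d01 : edgeDot (vertices θ α) 0 1 = c1 * c2 - s1 * s2 := by grind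
  have d04 : edgeDot (vertices θ α) 0 4 =
      -(1 + (c1 * c2 - s1 * s2) + (c0 * c2 - s0 * s2) + (c0 * c1 - s0 * s1)) := by grind
  have s12 : edgeCross (vertices θ α) 1 2 = s1 * c0 - c1 * s0 := by grind
  have s34 : edgeCross (vertices θ α) 3 4 =
      -((s0 * c1 + c0 * s1) + (s0 * c2 - c0 * s2) + (s1 * c2 - c1 * s2)) := by grind
  have s23 : edgeCross (vertices θ α) 2 3 = s2 * c1 - c2 * s1 := by grind
  have s14 : edgeCross (vertices θ α) 1 4 =
      -((s1 * c2 + c1 * s2) + (s1 * c0 - c1 * s0) + (s2 * c0 - c2 * s0)) := by grind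
  have d12 : edgeDot (vertices θ α) 1 2 = c1 * c0 + s1 * s0 := by grind
  have d10 : edgeDot (vertices θ α) 1 0 = c1 * c2 - s1 * s2 := by grind
  have s40 : edgeCross (vertices θ α) 4 0 =
      -((s1 * c2 + c1 * s2) + (s0 * c2 + c0 * s2) + (s0 * c1 + c0 * s1)) := by grind
  have s20 : edgeCross (vertices θ α) 2 0 = s0 * c2 + c0 * s2 := by grind
  have d23 : edgeDot (vertices θ α) 2 3 = c2 * c1 + s2 * s1 := by grind
  have d21 : edgeDot (vertices θ α) 2 1 = c1 * c0 + s1 * s0 := by grind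
  have s01 : edgeCross (vertices θ α) 0 1 = -(s1 * c2 + c1 * s2) := by grind
  have s31 : edgeCross (vertices θ α) 3 1 = s0 * c2 - c0 * s2 := by grind
  have d34 : edgeDot (vertices θ α) 3 4 =
      -((c0 * c1 - s0 * s1) + (c2 * c0 + s2 * s0) + (c2 * c1 + s2 * s1) + 1) := by grind
  have d32 : edgeDot (vertices θ α) 3 2 = c2 * c1 + s2 * s1 := by grind
  have s42 : edgeCross (vertices θ α) 4 2 =
      -((-(s0 * c2 + c0 * s2)) + (s1 * c0 - c1 * s0) + (s1 * c2 - c1 * s2)) := by grind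
  have d40 : edgeDot (vertices θ α) 4 0 =
      -(1 + (c1 * c2 - s1 * s2) + (c0 * c2 - s0 * s2) + (c0 * c1 - s0 * s1)) := by grind
  have d43 : edgeDot (vertices θ α) 4 3 =
      -((c0 * c1 - s0 * s1) + (c2 * c0 + s2 * s0) + (c2 * c1 + s2 * s1) + 1) := by grind
  have s03 : edgeCross (vertices θ α) 0 3 = -(s0 * c1 + c0 * s1) := by grind
  rw [d01, d04, s12, s34, s23, s14, d12, d10, s40, s20, d23, d21,
    s01, s31, d34, d32, s42, d40, d43, s03]
  clear d01 d04 s12 s34 s23 s14 d12 d10 s40 s20 d23 d21 s01 s31 d34 d32 s42 d40 d43 s03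
  clear r1 r2 x0 y0 x1 y1 x2 y2 x3 y3 x4 y4 e4
  grind

lemma magneticField_eq_vertexField (θ : ℝ) {α : Fin 3 → ℝ} (h : constraint α = 0) :
    magneticField α = vertexField (vertices θ α) := by
  have h1 := fieldNumerator_vertices θ α
  rw [h, mul_zero, add_zero] at h1
  rw [vertexField, ← inertia_eq_sum, eq_div_iff (pow_ne_zero 2 (inertia_ne_zero α)), ← h1, mul_comm]

lemma dihedral_invariance {g : Equiv.Perm (Fin 5 → ℂ)} (hg : g ∈ D10) {α : Fin 3 → ℝ}
    (hα : constraint α = 0) :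
    (∃ β : Fin 3 → ℝ, constraint β = 0 ∧ IsImage g α β) ∧
      ∀ β : Fin 3 → ℝ, constraint β = 0 → IsImage g α β →
        magneticField β = magneticField α := by
  have hs := isFieldSymmetry_of_mem hg
  refine ⟨?_, ?_⟩
  · obtain ⟨φ, β, hβ, h⟩ := (hs _ (isPentagon_vertices (θ := 0) hα)).1.exists_vertices_eq
    exact ⟨β, hβ, 0, φ, h⟩
  · rintro β hβ ⟨θ, φ, h⟩
    rw [magneticField_eq_vertexField φ hβ, h, (hs _ (isPentagon_vertices hα)).2,
      ← magneticField_eq_vertexField θ hα]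

/-! ### A differentiable retraction onto a regular level set -/

section Retraction

open Filter Topology

variable {E : Type*} [NormedAddCommGroup E] [NormedSpace ℝ E] [CompleteSpace E]

/-- A root of `f (x + l v(x))` as a function of `x`, where `f` increases along `v`, is as
differentiable as `f` and `v` if it is the only root in an interval. -/
lemma contDiffAt_root {n : WithTop ℕ∞} (hn : n ≠ 0) {Φ : E × ℝ → ℝ} (hΦ : ContDiff ℝ n Φ)
    {ℓ : E → ℝ} {η : ℝ} {V : Set E} (hV : IsOpen V) (hℓ : ∀ x ∈ V, ℓ x ∈ Ioo (-η) η)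
    (hroot : ∀ x ∈ V, Φ (x, ℓ x) = 0)
    (huniq : ∀ x ∈ V, ∀ l ∈ Ioo (-η) η, Φ (x, l) = 0 → l = ℓ x) {x : E} (hx : x ∈ V)
    (hd : fderiv ℝ Φ (x, ℓ x) (0, 1) ≠ 0) : ContDiffAt ℝ n ℓ x := by
  have hc : ContDiffAt ℝ n Φ (x, ℓ x) := hΦ.contDiffAt
  have hinv : (fderiv ℝ Φ (x, ℓ x) ∘L .inr ℝ E ℝ).IsInvertible := by
    refine ⟨ContinuousLinearEquiv.unitsEquivAut ℝ (Units.mk0 _ hd), ?_⟩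
    ext
    simp
  have h1 := hc.contDiffAt_implicitFunction hn hinv
  have h2 := hc.eventually_apply_implicitFunction hn hinv
  have h3 := hc.implicitFunction_apply_self hn hinv
  refine h1.congr_of_eventuallyEq ?_
  have h4 : ∀ᶠ y in 𝓝 x, hc.implicitFunction hn hinv y ∈ Ioo (-η) η := by
    refine h1.continuousAt.eventually_mem ?_
    rw [h3]
    exact isOpen_Ioo.mem_nhds (hℓ x hx)
  filter_upwards [h2, h4, hV.mem_nhds hx] with y hy2 hy4 hyV
  rw [hroot x hx] at hy2
  exact (huniq y hyV _ hy4 hy2).symm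

lemma exists_contDiffOn_retraction {n : WithTop ℕ∞} (hn : n ≠ 0) {f : E → ℝ} {v : E → E}
    (hf : ContDiff ℝ n f) (hv : ContDiff ℝ n v) {K : Set E} (hK : IsCompact K)
    (hK0 : ∀ x ∈ K, f x = 0) (hpos : ∀ x ∈ K, 0 < fderiv ℝ f x (v x)) :
    ∃ (V : Set E) (r : E → E), IsOpen V ∧ K ⊆ V ∧ ContDiffOn ℝ n r V ∧
      (∀ x ∈ V, f (r x) = 0) ∧ ∀ x ∈ V, f x = 0 → r x = x := by
  set Φ : E × ℝ → ℝ := fun y => f (y.1 + y.2 • v y.1) with hΦdef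
  have hΦ : ContDiff ℝ n Φ :=
    hf.comp (contDiff_fst.add (contDiff_snd.smul (hv.comp contDiff_fst)))
  have hdΦ : Continuous fun y => fderiv ℝ Φ y (0, 1) :=
    (hΦ.continuous_fderiv hn).clm_apply continuous_const
  have hline : ∀ x l, HasDerivAt (fun l => Φ (x, l)) (fderiv ℝ Φ (x, l) (0, 1)) l := by
    intro x l
    have h1 : HasFDerivAt Φ (fderiv ℝ Φ (x, l)) (x, l) :=
      (hΦ.differentiable hn (x, l)).hasFDerivAt
    exact h1.comp_hasDerivAt l ((hasDerivAt_const l x).prodMk (hasDerivAt_id l))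
  have hzero : ∀ x, Φ (x, 0) = f x := by simp [hΦdef]
  have hd0 : ∀ x, fderiv ℝ Φ (x, 0) (0, 1) = fderiv ℝ f x (v x) := by
    intro x
    refine (hline x 0).unique ?_
    have h1 : HasFDerivAt f (fderiv ℝ f x) (x + (0 : ℝ) • v x) := by
      simpa using (hf.differentiable hn x).hasFDerivAt
    have h2 : HasDerivAt (fun l : ℝ => x + l • v x) (v x) 0 := by
      simpa using ((hasDerivAt_id (0 : ℝ)).smul_const (v x)).const_add x
    exact h1.comp_hasDerivAt 0 h2
  obtain ⟨U, T, hU, hT, hKU, h0T, hUT⟩ := generalized_tube_lemma hK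
    (isCompact_singleton (x := (0 : ℝ))) (isOpen_lt continuous_const hdΦ) (n := {y | 0 < fderiv ℝ Φ y (0, 1)}) (by
      rintro ⟨x, l⟩ ⟨hx, rfl⟩
      simpa only [mem_ofPred_eq, hd0] using hpos x hx)
  obtain ⟨ρ, hρ, hρT⟩ := Metric.isOpen_iff.1 hT 0 (h0T rfl)
  set η := ρ / 2 with hη
  have hη0 : 0 < η := by positivity
  have hηT : ∀ l ∈ Icc (-η) η, l ∈ T := by
    intro l hl
    refine hρT ?_
    rw [Metric.mem_ball, Real.dist_eq, sub_zero, abs_lt]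
    constructor <;> linarith [hl.1, hl.2]
  have hmono : ∀ x ∈ U, StrictMonoOn (fun l => Φ (x, l)) (Icc (-η) η) := by
    intro x hx
    refine strictMonoOn_of_deriv_pos (convex_Icc _ _)
      (fun l _ => (hline x l).continuousAt.continuousWithinAt) fun l hl => ?_
    rw [(hline x l).deriv]
    exact hUT (show (x, l) ∈ U ×ˢ T from ⟨hx, hηT l (interior_subset hl)⟩)
  have hcont : ∀ l : ℝ, Continuous fun x => Φ (x, l) := fun l =>
    hΦ.continuous.comp (Continuous.prodMk_left l)
  set V : Set E := U ∩ ({x | Φ (x, -η) < 0} ∩ {x | 0 < Φ (x, η)}) with hVdef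
  have hV : IsOpen V := hU.inter ((isOpen_lt (hcont _) continuous_const).inter
    (isOpen_lt continuous_const (hcont _)))
  have hex : ∀ x ∈ V, ∃ l ∈ Ioo (-η) η, Φ (x, l) = 0 := by
    intro x hx
    exact intermediate_value_Ioo (by linarith)
      (fun l _ => (hline x l).continuousAt.continuousWithinAt) ⟨hx.2.1, hx.2.2⟩
  choose! ℓ hℓ hroot using hex
  have huniq : ∀ x ∈ V, ∀ l ∈ Ioo (-η) η, Φ (x, l) = 0 → l = ℓ x := fun x hx l hl h =>
    (hmono x hx.1).injOn (Ioo_subset_Icc_self hl) (Ioo_subset_Icc_self (hℓ x hx))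
      (h.trans (hroot x hx).symm)
  have hsm : ContDiffOn ℝ n ℓ V := fun x hx =>
    (contDiffAt_root hn hΦ hV hℓ hroot huniq hx
      (hUT (show (x, ℓ x) ∈ U ×ˢ T from
        ⟨hx.1, hηT _ (Ioo_subset_Icc_self (hℓ x hx))⟩)).ne').contDiffWithinAt
  refine ⟨V, fun x => x + ℓ x • v x, hV, fun x hx => ?_,
    contDiff_id.contDiffOn.add (hsm.smul hv.contDiffOn), hroot, fun x hx h => ?_⟩
  · have h0 : (0 : ℝ) ∈ Icc (-η) η := ⟨by linarith, hη0.le⟩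
    have hx0 : Φ (x, 0) = 0 := by rw [hzero, hK0 x hx]
    refine ⟨hKU hx, ?_, ?_⟩
    · exact (hmono x (hKU hx) ⟨le_rfl, by linarith⟩ h0 (by linarith : -η < 0)).trans_eq hx0
    · exact hx0.symm.trans_lt (hmono x (hKU hx) h0 ⟨by linarith, le_rfl⟩ hη0)
  · have : (0 : ℝ) = ℓ x := huniq x hx 0 ⟨by linarith, hη0⟩ (by rw [hzero, h])
    simp [← this]

end Retraction

/-! ### Differentiable approximation with fixed boundary values -/

section Approximation

variable {E : Type*} [NormedAddCommGroup E] [NormedSpace ℝ E]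

/-- A map which vanishes on two opposite sides, obtained by subtracting linear interpolation. -/
def subtractSides (P : ℝ × ℝ → E) (x : ℝ × ℝ) : E :=
  P x - (1 - x.1) • P (0, x.2) - x.1 • P (1, x.2)

lemma contDiff_subtractSides {n : WithTop ℕ∞} {P : ℝ × ℝ → E} (hP : ContDiff ℝ n P) :
    ContDiff ℝ n (subtractSides P) := by
  unfold subtractSides
  fun_prop

lemma norm_subtractSides_sub_le {P K : ℝ × ℝ → E} {ε : ℝ}
    (h : ∀ x ∈ closedSquare, ‖P x - K x‖ ≤ ε) (h0 : ∀ t ∈ Icc (0 : ℝ) 1, K (0, t) = 0)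
    (h1 : ∀ t ∈ Icc (0 : ℝ) 1, K (1, t) = 0) :
    ∀ x ∈ closedSquare, ‖subtractSides P x - K x‖ ≤ 2 * ε := by
  rintro ⟨s, t⟩ ⟨hs, ht⟩
  have a := h (s, t) ⟨hs, ht⟩
  have b : ‖P (0, t)‖ ≤ ε := by
    simpa [h0 t ht] using h (0, t) ⟨⟨le_rfl, zero_le_one⟩, ht⟩
  have c : ‖P (1, t)‖ ≤ ε := by
    simpa [h1 t ht] using h (1, t) ⟨⟨zero_le_one, le_rfl⟩, ht⟩
  have e : subtractSides P (s, t) - K (s, t) =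
      (P (s, t) - K (s, t)) - ((1 - s) • P (0, t) + s • P (1, t)) := by
    simp only [subtractSides]; abel
  have d : ‖(1 - s) • P (0, t) + s • P (1, t)‖ ≤ ε := by
    refine (norm_add_le _ _).trans ?_
    rw [norm_smul, norm_smul, Real.norm_of_nonneg (sub_nonneg.2 hs.2), Real.norm_of_nonneg hs.1]
    nlinarith [mul_le_mul_of_nonneg_left b (sub_nonneg.2 hs.2), mul_le_mul_of_nonneg_left c hs.1]
  rw [e]
  exact (norm_sub_le _ _).trans (by linarith)

lemma exists_contDiff_approx_vanishing {n : ℕ∞} {K : ℝ × ℝ → E} (hK : Continuous K)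
    (h0 : ∀ t ∈ Icc (0 : ℝ) 1, K (0, t) = 0) (h1 : ∀ t ∈ Icc (0 : ℝ) 1, K (1, t) = 0)
    (h0' : ∀ s ∈ Icc (0 : ℝ) 1, K (s, 0) = 0) (h1' : ∀ s ∈ Icc (0 : ℝ) 1, K (s, 1) = 0)
    {ε : ℝ} (hε : 0 < ε) :
    ∃ R : ℝ × ℝ → E, ContDiff ℝ n R ∧ (∀ t, R (0, t) = 0) ∧ (∀ t, R (1, t) = 0) ∧
      (∀ s, R (s, 0) = 0) ∧ (∀ s, R (s, 1) = 0) ∧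
      ∀ x ∈ closedSquare, ‖R x - K x‖ < ε := by
  obtain ⟨P, hP, hPK, -⟩ := hK.exists_contDiff_approx n (ε := fun _ => ε / 5) continuous_const
    fun _ => by positivity
  set Q := subtractSides P with hQ
  have hQc : ContDiff ℝ n Q := contDiff_subtractSides hP
  have hQK := norm_subtractSides_sub_le (P := P) (K := K) (ε := ε / 5)
    (fun x _ => by rw [← dist_eq_norm]; exact (hPK x).le) h0 h1
  have hR := norm_subtractSides_sub_le (P := Q ∘ Prod.swap) (K := K ∘ Prod.swap)
    (ε := 2 * (ε / 5)) (fun x hx => hQK x.swap ⟨hx.2, hx.1⟩) h0' h1'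
  refine ⟨subtractSides (Q ∘ Prod.swap) ∘ Prod.swap,
    (contDiff_subtractSides (hQc.comp (contDiff_snd.prodMk contDiff_fst))).comp
      (contDiff_snd.prodMk contDiff_fst), fun t => ?_, fun t => ?_, fun s => ?_, fun s => ?_,
    fun x hx => (hR x.swap ⟨hx.2, hx.1⟩).trans_lt (by linarith)⟩
  all_goals simp [subtractSides, hQ]

end Approximation

/-! ### Contractible loops bound discs -/

section Lifting

open scoped unitInterval

/-- Homotopies of based loops lift through covering maps, with the lifted base point fixed. -/
lemma exists_lift_of_nullhomotopy {E X : Type*} [TopologicalSpace E] [TopologicalSpace X]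
    {q : E → X} (cov : IsCoveringMap q) {x : X} (H : C(I × I, X)) (f : C(I, E))
    (hf : ∀ t, H (0, t) = q (f t)) (h1 : ∀ t, H (1, t) = x) (hs0 : ∀ s, H (s, 0) = x)
    (hs1 : ∀ s, H (s, 1) = x) :
    ∃ L : C(I × I, E), (∀ y, q (L y) = H y) ∧ (∀ t, L (0, t) = f t) ∧
      (∀ t, L (1, t) = f 0) ∧ (∀ s, L (s, 0) = f 0) ∧ ∀ s, L (s, 1) = f 0 := by
  set L := cov.liftHomotopy H f hf
  have hL : ∀ y, q (L y) = H y := congr_fun (cov.liftHomotopy_lifts H f hf)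
  have hL0 : ∀ t, L (0, t) = f t := cov.liftHomotopy_zero H f hf
  have e1 : ∀ s, L (s, 0) = f 0 := by
    intro s
    rw [← hL0 0]
    exact cov.const_of_comp (g := fun s => L (s, 0)) (by fun_prop)
      (fun a b => by rw [hL, hL, hs0, hs0]) s 0
  have e2 : ∀ t, L (1, t) = f 0 := by
    intro t
    rw [← e1 1]
    exact cov.const_of_comp (g := fun t => L (1, t)) (by fun_prop)
      (fun a b => by rw [hL, hL, h1, h1]) t 0
  have e3 : ∀ s, L (s, 1) = f 0 := by
    intro s
    rw [← e2 1]
    exact cov.const_of_comp (g := fun s => L (s, 1)) (by fun_prop)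
      (fun a b => by rw [hL, hL, hs1, hs1]) s 1
  exact ⟨L, hL, hL0, e2, e1, e3⟩

lemma isCoveringMap_angle : IsCoveringMap ((↑) : ℝ → Real.Angle) :=
  AddCircle.isCoveringMap_coe (2 * Real.pi)

/-- The shape coordinates as functions of the relative angles. -/
def shapeCoords (ψ : Fin 3 → ℝ) : Fin 3 → ℝ :=
  ![-ψ 0 / 2 - ψ 1 - ψ 2 / 2, Real.pi - ψ 0 / 2 - ψ 2 / 2, -ψ 0 / 2 + ψ 2 / 2]

lemma shapeCoords_relAngles (α : Fin 3 → ℝ) : shapeCoords (relAngles α) = α := by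
  ext i
  fin_cases i <;> simp [shapeCoords, relAngles] <;> ring

lemma relAngles_shapeCoords (ψ : Fin 3 → ℝ) : relAngles (shapeCoords ψ) = ψ := by
  ext i
  fin_cases i <;> simp [shapeCoords, relAngles] <;> ring

lemma continuous_shapeCoords : Continuous shapeCoords := by
  rw [continuous_pi_iff]
  intro i
  unfold shapeCoords
  fin_cases i <;> simp <;> fun_prop

lemma constraint_eq_zero_iff (α : Fin 3 → ℝ) : constraint α = 0 ↔
    (fun i => ((relAngles α i : ℝ) : Real.Angle)) ∈ shapeSpace := by
  simp only [shapeSpace, mem_ofPred_eq, ← Real.Angle.coe_add, Real.Angle.cos_coe]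
  have h0 : relAngles α 0 = Real.pi - (α 1 + α 2) := by simp [relAngles]; ring
  have h1 : relAngles α 1 = α 1 - α 0 - Real.pi := by simp [relAngles]; ring
  have h2 : relAngles α 2 = Real.pi - (α 1 - α 2) := by simp [relAngles]; ring
  have h01 : Real.pi - (α 1 + α 2) + (α 1 - α 0 - Real.pi) = -(α 0 + α 2) := by ring
  have h12 : α 1 - α 0 - Real.pi + (Real.pi - (α 1 - α 2)) = -(α 0 - α 2) := by ring
  have h012 : -(α 0 + α 2) + (Real.pi - (α 1 - α 2)) = Real.pi - (α 0 + α 1) := by ring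
  rw [h0, h1, h2, h01, h12, h012, Real.cos_sub_pi, Real.cos_neg, Real.cos_neg, Real.cos_pi_sub,
    Real.cos_pi_sub, Real.cos_pi_sub, Real.cos_add, Real.cos_add, Real.cos_add, Real.cos_sub,
    Real.cos_sub, Real.cos_sub, constraint]
  constructor <;> intro h <;> linarith

lemma continuous_relAngles : Continuous relAngles := by
  rw [continuous_pi_iff]
  intro i
  unfold relAngles
  fin_cases i <;> simp <;> fun_prop

/-- A null-homotopy of a loop lifts to the constraint surface. -/
lemma exists_lifted_nullhomotopy {p : shapeSpace} {γ : Path p p} {α : ℝ → Fin 3 → ℝ}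
    (hγ : Contractible γ) (hα : Represents α γ) (hc : ContinuousOn α (Icc 0 1)) :
    ∃ H : C(I × I, Fin 3 → ℝ), (∀ y, constraint (H y) = 0) ∧ (∀ t : I, H (1, t) = α t) ∧
      (∀ t, H (0, t) = α 0) ∧ (∀ s, H (s, 0) = α 0) ∧ ∀ s, H (s, 1) = α 0 := by
  obtain ⟨N⟩ := hγ
  have hαI : Continuous fun t : I => α t :=
    hc.comp_continuous continuous_subtype_val fun t => t.2
  have key : ∀ i : Fin 3, ∃ L : C(I × I, ℝ),
      (∀ y, ((L y : ℝ) : Real.Angle) = (N y : Fin 3 → Real.Angle) i) ∧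
      (∀ t, L (0, t) = relAngles (α t) i) ∧ (∀ t, L (1, t) = relAngles (α 0) i) ∧
      (∀ s, L (s, 0) = relAngles (α 0) i) ∧ ∀ s, L (s, 1) = relAngles (α 0) i := by
    intro i
    refine exists_lift_of_nullhomotopy isCoveringMap_angle (x := (p : Fin 3 → Real.Angle) i)
      ⟨fun y => (N y : Fin 3 → Real.Angle) i, (continuous_apply i).comp
        (continuous_subtype_val.comp N.continuous)⟩
      ⟨fun t => relAngles (α t) i, (continuous_apply i).comp (continuous_relAngles.comp hαI)⟩
      (fun t => ?_) (fun t => ?_) (fun s => ?_) fun s => ?_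
    · change (N (0, t) : Fin 3 → Real.Angle) i = ((relAngles (α t) i : ℝ) : Real.Angle)
      rw [N.apply_zero]
      exact hα t i
    · simp
    · simp
    · simp
  choose L hL h0 h1 hs0 hs1 using key
  refine ⟨⟨fun y => shapeCoords fun i => L i (σ y.1, y.2), continuous_shapeCoords.comp
    (continuous_pi fun i => by fun_prop)⟩, fun y => ?_, fun t => ?_, fun t => ?_, fun s => ?_,
    fun s => ?_⟩
  · rw [constraint_eq_zero_iff, ContinuousMap.coe_mk, relAngles_shapeCoords]
    simp only [hL]
    exact Subtype.coe_prop _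
  · simp only [ContinuousMap.coe_mk, unitInterval.symm_one, h0]
    exact shapeCoords_relAngles _
  · simp only [ContinuousMap.coe_mk, unitInterval.symm_zero, h1]
    exact shapeCoords_relAngles _
  · simp only [ContinuousMap.coe_mk, hs0]
    exact shapeCoords_relAngles _
  · simp only [ContinuousMap.coe_mk, hs1]
    exact shapeCoords_relAngles _

end Lifting

lemma contDiff_grad_constraint : ContDiff ℝ 2 (grad constraint) := by
  rw [funext grad_constraint, contDiff_pi]
  intro i
  fin_cases i <;> simp <;> fun_prop

/-- A loop with a continuous null-homotopy in the constraint surface bounds a `C²` disc. -/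
lemma exists_spanningDisc {α : ℝ → Fin 3 → ℝ} (hα : ContDiffOn ℝ 2 α (Icc 0 1))
    (H : C(unitInterval × unitInterval, Fin 3 → ℝ)) (hH : ∀ y, constraint (H y) = 0)
    (h1 : ∀ t : unitInterval, H (1, t) = α t) (h0 : ∀ t, H (0, t) = α 0)
    (hs0 : ∀ s, H (s, 0) = α 0) (hs1 : ∀ s, H (s, 1) = α 0) :
    ∃ σ : ℝ × ℝ → Fin 3 → ℝ, IsSpanningDisc α σ := by
  have hα1 : α 1 = α 0 := by simpa [hs1] using (h1 1).symm
  set pr : ℝ → unitInterval := projIcc 0 1 zero_le_one with hpr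
  have hprc : Continuous pr := continuous_projIcc
  have pr0 : pr 0 = 0 := projIcc_left _
  have pr1 : pr 1 = 1 := projIcc_right _
  have prt : ∀ t ∈ Icc (0 : ℝ) 1, (pr t : ℝ) = t := fun t ht => by
    rw [hpr, projIcc_of_mem zero_le_one ht]
  have hαI : Continuous fun t : ℝ => α (pr t) :=
    hα.continuousOn.comp_continuous (continuous_subtype_val.comp hprc) fun t => Subtype.coe_prop _
  have hKc : Continuous fun x : ℝ × ℝ =>
      H (pr x.1, pr x.2) - (α 0 + (pr x.1 : ℝ) • (α (pr x.2) - α 0)) :=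
    (H.continuous.comp (by fun_prop)).sub (continuous_const.add
      ((continuous_subtype_val.comp (hprc.comp continuous_fst)).smul
        ((hαI.comp continuous_snd).sub continuous_const)))
  obtain ⟨V, r, hV, hKV, hr, hrC, hrid⟩ := exists_contDiffOn_retraction (n := 2) (by simp)
    contDiff_constraint contDiff_grad_constraint (isCompact_range H.continuous)
    (by rintro _ ⟨y, rfl⟩; exact hH y) (by
      rintro _ ⟨y, rfl⟩
      rw [← grad_dotProduct]
      exact dotProduct_self_pos (grad_constraint_ne_zero (hH y)))
  obtain ⟨ε, hε, hεV⟩ := (isCompact_range H.continuous).exists_thickening_subset_open hV hKV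
  obtain ⟨R, hR, R0, R1, Rs0, Rs1, hRK⟩ := exists_contDiff_approx_vanishing (n := 2)
    (K := fun x : ℝ × ℝ => H (pr x.1, pr x.2) - (α 0 + (pr x.1 : ℝ) • (α (pr x.2) - α 0)))
    hKc (fun t _ => by simp [pr0, h0]) (fun t _ => by simp [pr1, h1])
    (fun s _ => by simp [pr0, hs0]) (fun s _ => by simp [pr1, hs1, hα1]) hε
  set g : ℝ × ℝ → Fin 3 → ℝ := fun x => α 0 + x.1 • (α x.2 - α 0) + R x with hg
  have hgc : ContDiffOn ℝ 2 g closedSquare := by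
    have hα2 : ContDiffOn ℝ 2 (fun x : ℝ × ℝ => α x.2) closedSquare :=
      hα.comp contDiff_snd.contDiffOn fun x hx => hx.2
    exact (contDiffOn_const.add (contDiff_fst.contDiffOn.smul (hα2.sub contDiffOn_const))).add
      hR.contDiffOn
  have hgV : ∀ x ∈ closedSquare, g x ∈ V := by
    intro x hx
    refine hεV (Metric.mem_thickening_iff.2 ⟨H (pr x.1, pr x.2), mem_range_self _, ?_⟩)
    have := hRK x hx
    rw [prt x.1 hx.1, prt x.2 hx.2] at this
    rw [dist_eq_norm]
    refine lt_of_eq_of_lt ?_ this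
    congr 1
    simp only [hg]
    abel
  have hid : ∀ y, r (H y) = H y := fun y => hrid _ (hKV (mem_range_self y)) (hH y)
  have hrα : ∀ t ∈ Icc (0 : ℝ) 1, r (α t) = α t := by
    intro t ht
    have := hid (1, ⟨t, ht⟩)
    rwa [h1] at this
  have hrα0 := hrα 0 ⟨le_rfl, zero_le_one⟩
  have gs0 : ∀ s, g (s, 0) = α 0 := fun s => by simp [hg, Rs0]
  have gs1 : ∀ s, g (s, 1) = α 0 := fun s => by simp [hg, Rs1, hα1]
  refine ⟨r ∘ g, hr.comp hgc hgV, fun x hx => hrC _ (hgV x hx), fun t ht => ?_, fun t _ => ?_,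
    fun s _ => ?_⟩
  · simp only [Function.comp_apply, hg, R1, one_smul, add_zero, add_sub_cancel]
    exact hrα t ht
  · simp [hg, R0, hrα0]
  · simp only [Function.comp_apply, gs0, gs1]

end Pentagon

end

theorem mainTheorem3 :
    -- `I` is the moment of inertia, and `L = I θ' + ∑ F̃ᵢ αᵢ'`
    (∀ (θ : ℝ) (α : Fin 3 → ℝ),
      inertia α = ∑ i, ‖vertices θ α i‖ ^ 2 ∧ 0 < inertia α) ∧
    (∀ (s : Set ℝ) (t : ℝ) (θ : ℝ → ℝ) (α : ℝ → Fin 3 → ℝ),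
      UniqueDiffWithinAt ℝ s t → DifferentiableWithinAt ℝ θ s t →
      DifferentiableWithinAt ℝ α s t →
      angularMomentum s (fun τ => vertices (θ τ) (α τ)) t =
        inertia (α t) * derivWithin θ s t + Ftilde (α t) ⬝ᵥ derivWithin α s t) ∧
    -- every `C¹` loop is realized at zero angular momentum, with rotation `∮ F · dα`
    (∀ (p : shapeSpace) (γ : Path p p) (α : ℝ → Fin 3 → ℝ),
      Represents α γ → ContDiffOn ℝ 1 α (Icc 0 1) →
      (∀ θ₀ : ℝ, ∃ θ : ℝ → ℝ, θ 0 = θ₀ ∧ ZeroMomentum θ α) ∧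
      ∀ θ : ℝ → ℝ, ZeroMomentum θ α → θ 1 - θ 0 = lineIntegral F α) ∧
    -- contractible loops: Stokes' theorem and the area integral of `B`
    (∀ (p : shapeSpace) (γ : Path p p) (α : ℝ → Fin 3 → ℝ) (θ : ℝ → ℝ),
      Contractible γ → Represents α γ → ContDiffOn ℝ 2 α (Icc 0 1) → ZeroMomentum θ α →
      α 1 = α 0 ∧
      (∃ σ : ℝ × ℝ → Fin 3 → ℝ, IsSpanningDisc α σ) ∧
      ∀ σ : ℝ × ℝ → Fin 3 → ℝ, IsSpanningDisc α σ →
        IntegrableOn (fun x => curl F (σ x) ⬝ᵥ normalVec σ x) square ∧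
        θ 1 - θ 0 = flux (curl F) σ ∧
        (∃ k : ℝ × ℝ → ℝ,
          (∀ x ∈ square,
            normalVec σ x = k x • grad constraint (σ x) ∧
            curl F (σ x) ⬝ᵥ normalVec σ x = k x * magneticField (σ x) ∧
            (normalVec σ x ≠ 0 → k x ≠ 0)) ∧
          θ 1 - θ 0 = ∫ x in square, k x * magneticField (σ x)) ∧
        ((∀ x ∈ square, normalVec σ x ≠ 0) →
          ∃ ε : ℝ, (ε = 1 ∨ ε = -1) ∧
            (∀ x ∈ square, normalVec σ x =
              (ε * len (normalVec σ x) / len (grad constraint (σ x))) •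
                grad constraint (σ x)) ∧
            IntegrableOn (fun x => magneticField (σ x) / len (grad constraint (σ x)) *
              len (normalVec σ x)) square ∧
            θ 1 - θ 0 =
              ε * areaIntegral (fun y => magneticField y / len (grad constraint y)) σ)) ∧
    -- the conversion factors do not vanish, also in the local coordinates `(α₁, α₂)`
    (∀ α : Fin 3 → ℝ, constraint α = 0 → grad constraint α ≠ 0) ∧
    (∀ (a : ℝ × ℝ → ℝ) (x : ℝ × ℝ), DifferentiableAt ℝ a x →
      (∀ᶠ y in nhds x, constraint ![y.1, y.2, a y] = 0) →
      partialD constraint 2 ![x.1, x.2, a x] ≠ 0 →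
      curl F ![x.1, x.2, a x] ⬝ᵥ normalVec (fun y => ![y.1, y.2, a y]) x =
          magneticField ![x.1, x.2, a x] / partialD constraint 2 ![x.1, x.2, a x] ∧
        len (normalVec (fun y => ![y.1, y.2, a y]) x) =
          len (grad constraint ![x.1, x.2, a x]) /
            |partialD constraint 2 ![x.1, x.2, a x]|) ∧
    -- the explicit formula for `B`
    (∀ α : Fin 3 → ℝ,
      5 / 8 * inertia α ^ 2 * magneticField α =
        Real.cos (3 * α 2) * (Real.cos (α 0) + Real.cos (α 1))
        + Real.cos (2 * α 2) * (3 + 2 * Real.cos (α 0 - α 1) + Real.cos (α 0 + α 1))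
        + Real.cos (α 2) * (Real.cos (α 0) + Real.cos (α 1) - Real.cos (3 * α 1)
            - Real.cos (2 * α 0 - α 1) - 2 * Real.cos (α 0 + 2 * α 1))
        + Real.sin (α 0) * Real.sin (α 1)
        - Real.cos (α 0) * (2 * Real.cos (α 1) + Real.cos (3 * α 1))
        - Real.cos (2 * α 0) - 2 * Real.cos (2 * α 1)) ∧
    -- `D₁₀` acts on shape space, and `B` is invariant
    (∀ g ∈ D10, ∀ α : Fin 3 → ℝ, constraint α = 0 →
      (∃ β : Fin 3 → ℝ, constraint β = 0 ∧ IsImage g α β) ∧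
      ∀ β : Fin 3 → ℝ, constraint β = 0 → IsImage g α β →
        magneticField β = magneticField α) := by
  refine ⟨fun θ α => ⟨inertia_eq_sum θ α, inertia_pos α⟩,
    fun s t θ α hs hθ hα => angularMomentum_vertices hs hθ hα,
    fun p γ α _ hα => ⟨exists_zeroMomentum hα, fun θ hθ => rotation_eq_lineIntegral hα hθ⟩,
    fun p γ α θ hγ hαγ hα hθ => ?_, fun α hα => grad_constraint_ne_zero hα,
    fun a x ha h h3 => graph_flux ha h h3, magneticField_formula,
    fun g hg α hα => dihedral_invariance hg hα⟩
  obtain ⟨H, hH, h1, h0, hs0, hs1⟩ := exists_lifted_nullhomotopy hγ hαγ hα.continuousOn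
  refine ⟨by simpa [hs1] using (h1 1).symm, exists_spanningDisc hα H hH h1 h0 hs0 hs1,
    fun σ hσ => flux_curl_eq_integral_magneticField hσ ?_⟩
  rw [rotation_eq_lineIntegral (hα.of_le (by norm_num)) hθ,
    flux_curl_eq_lineIntegral contDiff_F hσ]
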